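/- Let $d\ge 1$ and let $\mathbb R_d$ be the real Clifford algebra generated by $e_1,\dots,e_d$ with $e_i^2=-1$, $e_ie_j=-e_je_i$ $(i\ne j)$, with basis $e_A=e_{i_1}\cdots e_{i_r}$, $A=\{i_1<\dots<i_r\}\subseteq\{1,\dots,d\}$, and $|s|^2=\sum_A s_A^2$. Let $\mathbb R^{d+1}=\{s_0+s_1e_1+\dots+s_de_d\}$ be the paravectors, $\overline s=s_0-s_1e_1-\dots-s_de_d$, $\mathbb S=\{J\in\mathbb R^{d+1}: J_0=0,\ |J|=1\}$, and $\mathbb C_J=\{x+Jy: x,y\in\mathbb R\}$ for $J\in\mathbb S$. For $\omega\in(0,\frac\pi2)$ put $I_\omega=(-\omega,\omega)\cup(\pi-\omega,\pi+\omega)$ and $D_\omega=\{te^{J\phi}: t>0,\ J\in\mathbb S,\ \phi\in I_\omega\}$. A function $f:D_\theta\to\mathbb R_d$ is *left slice hyperholomorphic* if there are continuously differentiable $f_0,f_1:\{(x,y)\in\mathbb R^2: x+\mathbb S y\subseteq D_\theta\}\to\mathbb R_d$ with $f(x+Jy)=f_0(x,y)+Jf_1(x,y)$ for all $J\in\mathbb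 S$, $f_0(x,-y)=f_0(x,y)$, $f_1(x,-y)=-f_1(x,y)$, $\partial_xf_0=\partial_yf_1$ and $\partial_yf_0=-\partial_xf_1$. Let $\mathcal{SH}_L^0(D_\theta)$ be the set of all bounded left slice hyperholomorphic $f$ on $D_\theta$ with $\int_0^\infty|f(te^{J\phi})|\frac{dt}{t}<\infty$ for all $J\in\mathbb S$, $\phi\in I_\theta$. Let $V_{\mathbb R}$ be a real Banach space and $V=\{\sum_A v_A\otimes e_A: v_A\in V_{\mathbb R}\}$ the two-sided $\mathbb R_d$-module with norm $\|v\|^2=\sum_A\|v_A\|^2$. Let $T:\operatorname{dom}(T)\to V$ be a closed right-linear operator whose domain is a two-sided linear subspace of $V$. Powers $T^k$ have their natural domains ($T^0$ is the identity on $V$), and for a real polynomial $p(s)=p_0+p_1s+\dots+p_ns^n$ of degree $n$ put $p[T]=p_0+p_1T+\dots+p_nT^n$ with $\operatorname{dom}(p[T])=\operatorname{dom}(T^n)$. For $s\in\mathbb R^{d+1}$ put $Q_s[T]=T^2-2s_0T+|s|^2$ on $\operatorname{dom}(T^2)$. The set $\rho_S(T)$ consists of all $s$ such that $Q_s[T]$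 is bijective onto $V$ with bounded right-linear inverse; $\sigma_S(T)=\mathbb R^{d+1}\setminus\rho_S(T)$; and for $s\in\rho_S(T)$, $S_L^{-1}(s,T)=Q_s[T]^{-1}\overline s-TQ_s[T]^{-1}$. The operator $T$ is *bisectorial of angle* $\omega\in(0,\frac\pi2)$ if $\sigma_S(T)\subseteq\overline{D_\omega}$ and for every $\varphi\in(\omega,\frac\pi2)$ there is $C_\varphi\ge0$ with $\|S_L^{-1}(s,T)\|\le C_\varphi/|s|$ for all $s\in\mathbb R^{d+1}\setminus(D_\varphi\cup\{0\})$. In that case, for $\theta\in(\omega,\frac\pi2)$ and $f\in\mathcal{SH}_L^0(D_\theta)$, define the bounded operator $$f(T)=\frac1{2\pi}\int_{\partial D_\varphi\cap\mathbb C_J}S_L^{-1}(s,T)\,ds_J\,f(s),\qquad ds_J=\frac{ds}{J},$$ where $\partial D_\varphi\cap\mathbb C_J$ is positively oriented and $\varphi\in(\omega,\theta)$, $J\in\mathbb S$ are arbitrary (the operator does not depend on them). **Proposition.** Let $T$ be bisectorial of angle $\omega\in(0,\frac\pi2)$, $\theta\in(\omega,\frac\pi2)$, $f\in\mathcal{SH}_L^0(D_\theta)$,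 and let $p$ be a polynomial of degree $n\in\mathbb N_0$ with real coefficients such that $pf\in\mathcal{SH}_L^0(D_\theta)$. Then $\operatorname{ran}(f(T))\subseteq\operatorname{dom}(T^n)$ and $$(pf)(T)=p[T]\,f(T),$$ whichever $\varphi\in(\omega,\theta)$ and $J\in\mathbb S$ are used to compute each of $f(T)$ and $(pf)(T)$. -/

import Mathlib

noncomputable section

/-- The quadratic form `x ↦ -(x₁² + ⋯ + x_d²)` on `ℝ^d`. -/
def cliffordForm (d : ℕ) : QuadraticForm ℝ (Fin d → ℝ) :=
  QuadraticMap.weightedSumSquares ℝ (fun _ : Fin d => (-1 : ℝ))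

/-- The real Clifford algebra with `d` imaginary units. -/
abbrev Cliff (d : ℕ) : Type := CliffordAlgebra (cliffordForm d)

namespace Cliff

/-- The imaginary unit `e_i`. -/
def unit {d : ℕ} (i : Fin d) : Cliff d := CliffordAlgebra.ι (cliffordForm d) (Pi.single i 1)

/-- The basis vector `e_A = e_{i₁} ⋯ e_{i_r}` for `A = {i₁ < ⋯ < i_r}`. -/
def basisVec {d : ℕ} (A : Finset (Fin d)) : Cliff d := ((A.sort (· ≤ ·)).map unit).prod

theorem unit_mul_self {d : ℕ} (i : Fin d) : (unit i * unit i : Cliff d) = -1 := by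
  have h : cliffordForm d (Pi.single i 1) = -1 := by
    simp [cliffordForm, QuadraticMap.weightedSumSquares_apply, Pi.single_apply]
  rw [unit, CliffordAlgebra.ι_sq_scalar, h]
  simp only [map_neg, map_one]

theorem unit_mul_unit {d : ℕ} {i j : Fin d} (h : i ≠ j) :
    (unit i * unit j : Cliff d) = -(unit j * unit i) := by
  apply CliffordAlgebra.ι_mul_ι_comm_of_isOrtho
  rw [QuadraticMap.isOrtho_def]
  simp only [cliffordForm, QuadraticMap.weightedSumSquares_apply, ← Finset.sum_add_distrib]
  refine Finset.sum_congr rfl fun k _ => ?_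
  simp only [Pi.add_apply, Pi.single_apply]
  by_cases h1 : k = i
  · subst h1; simp [h]
  · simp [h1]

/-- The sign of `e_i e_A = ± e_{A ∆ {i}}`. -/
def sgn {d : ℕ} (i : Fin d) (A : Finset (Fin d)) : ℝ := (-1) ^ (A.filter (· ≤ i)).card

theorem sgn_mul_self {d : ℕ} (i : Fin d) (A : Finset (Fin d)) : sgn i A * sgn i A = 1 := by
  rw [sgn, ← mul_pow]; simp

theorem sgn_symmDiff {d : ℕ} (i j : Fin d) (A : Finset (Fin d)) :
    sgn i (symmDiff A {j}) = if j ≤ i then -sgn i A else sgn i A := by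
  have key : ∀ B : Finset (Fin d), j ∉ B →
      sgn i (insert j B) = if j ≤ i then -sgn i B else sgn i B := by
    intro B hB
    unfold sgn
    rw [Finset.filter_insert]
    split_ifs with h
    · rw [Finset.card_insert_of_notMem (by simp [hB]), pow_succ]; ring
    · rfl
  by_cases hj : j ∈ A
  · have h1 : symmDiff A {j} = A.erase j := by
      ext k; by_cases hk : k = j <;> simp [Finset.mem_symmDiff, hk, hj]
    have h2 := key (A.erase j) (by simp)
    rw [Finset.insert_erase hj] at h2
    rw [h1]
    split_ifs at h2 ⊢ with h
    · rw [h2]; ring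
    · rw [h2]
  · have h1 : symmDiff A {j} = insert j A := by
      ext k; by_cases hk : k = j <;> simp [Finset.mem_symmDiff, hk, hj]
    rw [h1, key A hj]

/-- Left multiplication by `e_i` in coordinates. -/
def flip {d : ℕ} (i : Fin d) : Module.End ℝ (Finset (Fin d) → ℝ) where
  toFun w := fun C => sgn i (symmDiff C {i}) * w (symmDiff C {i})
  map_add' v w := by ext C; simp [mul_add]
  map_smul' a w := by ext C; simp; ring

theorem flip_anticomm {d : ℕ} (i j : Fin d) :
    flip i * flip j + flip j * flip i = algebraMap ℝ _ (if i = j then -2 else 0) := by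
  apply LinearMap.ext; intro w; ext C
  simp only [flip, LinearMap.add_apply, Module.End.mul_apply, LinearMap.coe_mk, AddHom.coe_mk,
    Pi.add_apply, Module.algebraMap_end_apply, Pi.smul_apply, smul_eq_mul]
  by_cases h : i = j
  · subst h
    simp only [sgn_symmDiff, le_refl, if_true, symmDiff_symmDiff_cancel_right]
    have := sgn_mul_self i C
    linear_combination (-2 * w C) * this
  · rw [symmDiff_right_comm C {j} {i}]
    simp only [sgn_symmDiff, le_refl, if_true, h, if_false]
    rcases lt_or_gt_of_ne h with h' | h'
    · simp [h'.le, h'.not_ge]; ring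
    · simp [h'.le, h'.not_ge]; ring

/-- Left multiplication by a vector in coordinates. -/
def vecFlip (d : ℕ) : (Fin d → ℝ) →ₗ[ℝ] Module.End ℝ (Finset (Fin d) → ℝ) :=
  ∑ i, (LinearMap.proj i : (Fin d → ℝ) →ₗ[ℝ] ℝ).smulRight (flip i)

theorem vecFlip_sq {d : ℕ} (m : Fin d → ℝ) :
    vecFlip d m * vecFlip d m = algebraMap ℝ _ (cliffordForm d m) := by
  have h1 : vecFlip d m = ∑ i, m i • flip i := by simp [vecFlip]
  have h2 : vecFlip d m * vecFlip d m = ∑ i, ∑ j, (m i * m j) • (flip i * flip j) := by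
    rw [h1, Finset.sum_mul_sum]
    refine Finset.sum_congr rfl fun i _ => Finset.sum_congr rfl fun j _ => ?_
    rw [smul_mul_smul_comm]
  have h3 : vecFlip d m * vecFlip d m = ∑ i, ∑ j, (m i * m j) • (flip j * flip i) := by
    rw [h2, Finset.sum_comm]
    refine Finset.sum_congr rfl fun i _ => Finset.sum_congr rfl fun j _ => ?_
    rw [mul_comm (m i)]
  have h4 : (2 : ℝ) • (vecFlip d m * vecFlip d m)
      = (2 : ℝ) • algebraMap ℝ (Module.End ℝ (Finset (Fin d) → ℝ)) (cliffordForm d m) := by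
    rw [two_smul]
    nth_rw 1 [h2]
    rw [h3]
    simp only [← Finset.sum_add_distrib, ← smul_add, flip_anticomm]
    simp only [Algebra.algebraMap_eq_smul_one, smul_smul, ← Finset.sum_smul]
    congr 1
    simp [cliffordForm, QuadraticMap.weightedSumSquares_apply]
    rw [Finset.mul_sum]
    exact Finset.sum_congr rfl fun i _ => by ring
  exact smul_right_injective _ (two_ne_zero) h4

/-- The left regular representation in coordinates. -/
def leftRep (d : ℕ) : Cliff d →ₐ[ℝ] Module.End ℝ (Finset (Fin d) → ℝ) :=
  CliffordAlgebra.lift (cliffordForm d) ⟨vecFlip d, vecFlip_sq⟩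

theorem leftRep_unit {d : ℕ} (i : Fin d) : leftRep d (unit i) = flip i := by
  rw [leftRep, unit, CliffordAlgebra.lift_ι_apply]
  simp [vecFlip, Pi.single_apply]

theorem leftRep_list {d : ℕ} (l : List (Fin d)) (hl : l.Pairwise (· < ·)) :
    leftRep d ((l.map unit).prod) (Pi.single ∅ 1) = Pi.single l.toFinset 1 := by
  induction l with
  | nil => simp
  | cons i l ih =>
    rw [List.pairwise_cons] at hl
    rw [List.map_cons, List.prod_cons, map_mul, Module.End.mul_apply, ih hl.2, leftRep_unit]
    have hi : i ∉ l.toFinset := fun h => (hl.1 i (by simpa using h)).false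
    have hs : symmDiff l.toFinset {i} = (i :: l).toFinset := by
      ext k; by_cases hk : k = i <;> simp [Finset.mem_symmDiff, hk]
      simpa using hi
    have h0 : sgn i l.toFinset = 1 := by
      rw [sgn, Finset.filter_false_of_mem]
      · simp
      · intro k hk; exact (hl.1 k (by simpa using hk)).not_ge
    ext C
    simp only [flip, LinearMap.coe_mk, AddHom.coe_mk, Pi.single_apply]
    by_cases hC : C = (i :: l).toFinset
    · have : symmDiff C {i} = l.toFinset := by rw [hC, ← hs, symmDiff_symmDiff_cancel_right]
      rw [this, if_pos rfl, if_pos hC, h0, one_mul]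
    · have : symmDiff C {i} ≠ l.toFinset := by
        intro h; apply hC; rw [← hs, ← h, symmDiff_symmDiff_cancel_right]
      rw [if_neg this, if_neg hC, mul_zero]

theorem leftRep_basisVec {d : ℕ} (A : Finset (Fin d)) :
    leftRep d (basisVec A) (Pi.single ∅ 1) = Pi.single A 1 := by
  rw [basisVec, leftRep_list _ (Finset.sortedLT_sort A).pairwise, Finset.sort_toFinset]

theorem linearIndependent_basisVec (d : ℕ) :
    LinearIndependent ℝ (basisVec : Finset (Fin d) → Cliff d) := by
  have h := (Pi.basisFun ℝ (Finset (Fin d))).linearIndependent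
  refine LinearIndependent.of_comp
    ((LinearMap.applyₗ (Pi.single ∅ 1)).comp (leftRep d).toLinearMap) ?_
  convert h using 1
  ext1 A
  simp [leftRep_basisVec]

theorem unit_mul_list {d : ℕ} (i : Fin d) (l : List (Fin d)) (hl : l.Pairwise (· < ·)) :
    unit i * (l.map unit).prod ∈ Submodule.span ℝ
      {x : Cliff d | ∃ l' : List (Fin d), l'.Pairwise (· < ·) ∧ (∀ k ∈ l', k = i ∨ k ∈ l) ∧
        x = (l'.map unit).prod} := by
  induction l with
  | nil => exact Submodule.subset_span ⟨[i], by simp, by simp, by simp⟩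
  | cons a l ih =>
    rw [List.pairwise_cons] at hl
    rw [List.map_cons, List.prod_cons]
    rcases lt_trichotomy i a with h | h | h
    · refine Submodule.subset_span ⟨i :: a :: l, ?_, by simp, by simp⟩
      simp only [List.pairwise_cons, List.mem_cons]
      refine ⟨?_, hl⟩
      rintro k (rfl | hk)
      · exact h
      · exact h.trans (hl.1 k hk)
    · subst h
      rw [← mul_assoc, unit_mul_self, neg_one_mul]
      exact Submodule.neg_mem _ (Submodule.subset_span ⟨l, hl.2, fun k hk => by simp [hk], rfl⟩)
    · rw [← mul_assoc, unit_mul_unit h.ne', neg_mul, mul_assoc]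
      refine Submodule.neg_mem _ ?_
      have h1 := Submodule.mem_map_of_mem (f := LinearMap.mulLeft ℝ (unit a : Cliff d)) (ih hl.2)
      rw [Submodule.map_span] at h1
      refine Submodule.span_mono ?_ h1
      rintro _ ⟨_, ⟨l', hl', hm, rfl⟩, rfl⟩
      refine ⟨a :: l', ?_, ?_, by simp⟩
      · rw [List.pairwise_cons]
        refine ⟨fun k hk => ?_, hl'⟩
        rcases hm k hk with rfl | hk
        · exact h
        · exact hl.1 k hk
      · intro k hk
        rcases List.mem_cons.1 hk with rfl | hk
        · simp
        · rcases hm k hk with rfl | hk <;> simp [*]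

theorem list_mem_range {d : ℕ} (l : List (Fin d)) (hl : l.Pairwise (· < ·)) :
    ((l.map unit).prod : Cliff d) ∈ Set.range (basisVec (d := d)) := by
  refine ⟨l.toFinset, ?_⟩
  rw [basisVec]
  congr 2
  exact (List.toFinset_sort (· ≤ ·) (hl.imp fun h => h.ne)).2 (hl.imp fun h => h.le)

theorem span_basisVec (d : ℕ) :
    ⊤ ≤ Submodule.span ℝ (Set.range (basisVec : Finset (Fin d) → Cliff d)) := by
  have hu : ∀ (i : Fin d), ∀ x ∈ Submodule.span ℝ (Set.range (basisVec (d := d))),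
      unit i * x ∈ Submodule.span ℝ (Set.range (basisVec (d := d))) := by
    intro i x hx
    have h1 := Submodule.mem_map_of_mem (f := LinearMap.mulLeft ℝ (unit i : Cliff d)) hx
    rw [Submodule.map_span] at h1
    refine Submodule.span_le.2 ?_ h1
    rintro _ ⟨_, ⟨A, rfl⟩, rfl⟩
    refine Submodule.span_mono ?_ (unit_mul_list i _ (Finset.sortedLT_sort A).pairwise)
    rintro _ ⟨l', hl', -, rfl⟩
    exact list_mem_range l' hl'
  intro x _
  induction x using CliffordAlgebra.left_induction with
  | algebraMap r =>
    rw [Algebra.algebraMap_eq_smul_one]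
    exact Submodule.smul_mem _ _ (Submodule.subset_span ⟨∅, by simp [basisVec]⟩)
  | add x y hx hy => exact Submodule.add_mem _ (hx trivial) (hy trivial)
  | ι_mul x m hx =>
    have hm : CliffordAlgebra.ι (cliffordForm d) m = ∑ i, m i • (unit i : Cliff d) := by
      simp only [unit, ← map_smul, ← map_sum]
      congr 1
      ext k
      simp [Finset.sum_apply, Pi.single_apply]
    rw [hm, Finset.sum_mul]
    refine Submodule.sum_mem _ fun i _ => ?_
    rw [smul_mul_assoc]
    exact Submodule.smul_mem _ _ (hu i x (hx trivial))

/-- The basis `(e_A)` of the Clifford algebra. -/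
def basis (d : ℕ) : Module.Basis (Finset (Fin d)) ℝ (Cliff d) :=
  Module.Basis.mk (linearIndependent_basisVec d) (span_basisVec d)

/-- The coordinates `(s_A)`, as a vector with the Euclidean norm. -/
def coords (d : ℕ) : Cliff d ≃ₗ[ℝ] EuclideanSpace ℝ (Finset (Fin d)) :=
  (basis d).equivFun.trans (WithLp.linearEquiv 2 ℝ (Finset (Fin d) → ℝ)).symm

end Cliff

/-- The absolute value `|s|² = ∑_A s_A²`. -/
instance Cliff.instNormedAddCommGroup (d : ℕ) : NormedAddCommGroup (Cliff d) :=
  NormedAddCommGroup.induced (Cliff d) (EuclideanSpace ℝ (Finset (Fin d))) (Cliff.coords d)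
    (Cliff.coords d).injective

instance Cliff.instNormedSpace (d : ℕ) : NormedSpace ℝ (Cliff d) :=
  NormedSpace.induced ℝ (Cliff d) (EuclideanSpace ℝ (Finset (Fin d))) (Cliff.coords d)

/-- The space `ℝ^{d+1}` of paravectors `s₀ + s₁e₁ + ⋯ + s_de_d`, with the modulus as norm. -/
abbrev Paravector (d : ℕ) : Type := EuclideanSpace ℝ (Fin (d + 1))

namespace Paravector

variable {d : ℕ}

/-- A paravector as a Clifford number. -/
def toCliff (s : Paravector d) : Cliff d :=
  algebraMap ℝ (Cliff d) (s 0) + ∑ i : Fin d, s i.succ • Cliff.unit i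

/-- The real unit as a paravector. -/
def one : Paravector d := EuclideanSpace.single 0 1

/-- The conjugate `s₀ - s₁e₁ - ⋯ - s_de_d`. -/
def conj (s : Paravector d) : Paravector d := (2 * s 0) • one - s

/-- The sphere `𝕊` of purely imaginary paravectors of modulus one. -/
def unitSphere (d : ℕ) : Set (Paravector d) := {J | J 0 = 0 ∧ ‖J‖ = 1}

/-- The paravector `x + Jy`. -/
def slicePoint (J : Paravector d) (x y : ℝ) : Paravector d := x • one + y • J

/-- The paravector `t e^{Jφ}`. -/
def polar (J : Paravector d) (t φ : ℝ) : Paravector d :=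
  slicePoint J (t * Real.cos φ) (t * Real.sin φ)

/-- The set `I_ω = (-ω, ω) ∪ (π - ω, π + ω)` of angles. -/
def angles (ω : ℝ) : Set ℝ := Set.Ioo (-ω) ω ∪ Set.Ioo (Real.pi - ω) (Real.pi + ω)

/-- The open double sector `D_ω = {s ≠ 0 : Arg s ∈ I_ω}`. -/
def doubleSector (d : ℕ) (ω : ℝ) : Set (Paravector d) :=
  {s | ∃ J ∈ unitSphere d, ∃ t : ℝ, 0 < t ∧ ∃ φ ∈ angles ω, s = polar J t φ}

end Paravector

open Paravector in
/-- Left slice hyperholomorphic functions on an open axially symmetric set `U` (only the values of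
`f` on `U` matter). -/
def IsLeftSliceHyperholomorphic {d : ℕ} (U : Set (Paravector d)) (f : Paravector d → Cliff d) :
    Prop :=
  ∃ f₀ f₁ : ℝ × ℝ → Cliff d,
    ContDiffOn ℝ 1 f₀ {z | ∀ J ∈ unitSphere d, slicePoint J z.1 z.2 ∈ U} ∧
    ContDiffOn ℝ 1 f₁ {z | ∀ J ∈ unitSphere d, slicePoint J z.1 z.2 ∈ U} ∧
    ∀ x y : ℝ, (∀ J ∈ unitSphere d, slicePoint J x y ∈ U) →
      (∀ J ∈ unitSphere d, f (slicePoint J x y) = f₀ (x, y) + J.toCliff * f₁ (x, y)) ∧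
      f₀ (x, -y) = f₀ (x, y) ∧ f₁ (x, -y) = -f₁ (x, y) ∧
      fderiv ℝ f₀ (x, y) (1, 0) = fderiv ℝ f₁ (x, y) (0, 1) ∧
      fderiv ℝ f₀ (x, y) (0, 1) = -fderiv ℝ f₁ (x, y) (1, 0)

open Paravector in
/-- The space `SH_L^0(D_θ)`: the bounded left slice hyperholomorphic functions on `D_θ` with
`∫₀^∞ |f(te^{Jφ})| dt/t < ∞` for all `J ∈ 𝕊` and `φ ∈ I_θ`. -/
structure MemSHL0 {d : ℕ} (θ : ℝ) (f : Paravector d → Cliff d) : Prop where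
  slice : IsLeftSliceHyperholomorphic (doubleSector d θ) f
  bounded : ∃ C : ℝ, ∀ s ∈ doubleSector d θ, ‖f s‖ ≤ C
  integrable : ∀ J ∈ unitSphere d, ∀ φ ∈ angles θ,
    MeasureTheory.IntegrableOn (fun t : ℝ => ‖f (polar J t φ)‖ / t) (Set.Ioi 0)

/-- The Clifford module `V = {∑_A v_A ⊗ e_A : v_A ∈ E}` over a real normed space `E`, with the norm
`‖v‖² = ∑_A ‖v_A‖²`. -/
abbrev CliffModule (d : ℕ) (E : Type*) : Type _ := PiLp 2 (fun _ : Finset (Fin d) => E)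

namespace CliffModule

variable {d : ℕ} {E : Type*} [NormedAddCommGroup E] [NormedSpace ℝ E]

/-- The operator `id ⊗ R` on `V`, i.e. `v ⊗ e_A ↦ v ⊗ R e_A`. -/
def amplify (R : Cliff d →ₗ[ℝ] Cliff d) : CliffModule d E →L[ℝ] CliffModule d E :=
  (PiLp.continuousLinearEquiv 2 ℝ (fun _ : Finset (Fin d) => E)).symm.toContinuousLinearMap ∘L
    ContinuousLinearMap.pi (fun C : Finset (Fin d) => ∑ A : Finset (Fin d),
      (Cliff.basis d).repr (R (Cliff.basisVec A)) C •
        (PiLp.proj 2 (fun _ : Finset (Fin d) => E) A : CliffModule d E →L[ℝ] E))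

/-- Left multiplication `v ↦ sv`. -/
def leftMul (s : Cliff d) : CliffModule d E →L[ℝ] CliffModule d E :=
  amplify (LinearMap.mulLeft ℝ s)

/-- Right multiplication `v ↦ vs`. -/
def rightMul (s : Cliff d) : CliffModule d E →L[ℝ] CliffModule d E :=
  amplify (LinearMap.mulRight ℝ s)

end CliffModule

section Operators

variable {V : Type*} [AddCommGroup V] [Module ℝ V]

/-- The composition `S T` with its natural domain `{v ∈ dom T : Tv ∈ dom S}`. -/
def opComp (S T : V →ₗ.[ℝ] V) : V →ₗ.[ℝ] V where
  domain :=
    { carrier := {v | ∃ h : v ∈ T.domain, T ⟨v, h⟩ ∈ S.domain}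
      zero_mem' := ⟨T.domain.zero_mem, by
        rw [show (⟨0, T.domain.zero_mem⟩ : T.domain) = 0 from rfl, T.map_zero]
        exact S.domain.zero_mem⟩
      add_mem' := by
        rintro v w ⟨hv, hv'⟩ ⟨hw, hw'⟩
        exact ⟨T.domain.add_mem hv hw, by
          rw [show (⟨v + w, T.domain.add_mem hv hw⟩ : T.domain) = ⟨v, hv⟩ + ⟨w, hw⟩ from rfl,
            T.map_add]
          exact S.domain.add_mem hv' hw'⟩
      smul_mem' := by
        rintro a v ⟨hv, hv'⟩
        exact ⟨T.domain.smul_mem a hv, by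
          rw [show (⟨a • v, T.domain.smul_mem a hv⟩ : T.domain) = a • ⟨v, hv⟩ from rfl,
            T.map_smul]
          exact S.domain.smul_mem a hv'⟩ }
  toFun :=
    { toFun := fun v => S ⟨T ⟨v, v.2.fst⟩, v.2.snd⟩
      map_add' := by
        intro v w
        rw [← S.map_add]
        congr 1
        exact Subtype.ext (T.map_add ⟨v, v.2.fst⟩ ⟨w, w.2.fst⟩)
      map_smul' := by
        intro a v
        rw [RingHom.id_apply, ← S.map_smul]
        congr 1
        exact Subtype.ext (T.map_smul a ⟨v, v.2.fst⟩) }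

/-- The powers `T^k`, with `T^0 = id` on all of `V` and `T^{k+1} = T T^k`. -/
def opPow (T : V →ₗ.[ℝ] V) : ℕ → (V →ₗ.[ℝ] V)
  | 0 => LinearMap.toPMap LinearMap.id ⊤
  | k + 1 => opComp T (opPow T k)

theorem opPow_domain_anti (T : V →ₗ.[ℝ] V) : Antitone fun k => (opPow T k).domain :=
  antitone_nat_of_succ_le fun _ _ hv => hv.fst

/-- The operator `p[T] = p₀ + p₁T + ⋯ + p_nT^n` with `n = deg p` and domain `dom(T^n)`. -/
def polyOp (T : V →ₗ.[ℝ] V) (p : Polynomial ℝ) : V →ₗ.[ℝ] V where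
  domain := (opPow T p.natDegree).domain
  toFun := ∑ k : Fin (p.natDegree + 1), p.coeff k •
    (opPow T k).toFun ∘ₗ Submodule.inclusion (opPow_domain_anti T (Nat.lt_succ_iff.1 k.2))

end Operators

namespace CliffModule

open Paravector

variable {d : ℕ} {E : Type*} [NormedAddCommGroup E] [NormedSpace ℝ E]

/-- The class `𝒦(V)` of closed right-linear operators with two-sided linear domain. -/
structure IsClosedOperator (T : CliffModule d E →ₗ.[ℝ] CliffModule d E) : Prop where
  leftMul_mem : ∀ (s : Cliff d), ∀ v ∈ T.domain, leftMul s v ∈ T.domain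
  rightMul_mem : ∀ (s : Cliff d), ∀ v ∈ T.domain, rightMul s v ∈ T.domain
  map_rightMul : ∀ (s : Cliff d) (v : T.domain),
    T ⟨rightMul s v, rightMul_mem s v v.2⟩ = rightMul s (T v)
  closed : T.IsClosed

/-- The operator `Q_s[T] = T² - 2s₀T + |s|²` with domain `dom(T²)`. -/
def Qop (T : CliffModule d E →ₗ.[ℝ] CliffModule d E) (s : Paravector d) :
    CliffModule d E →ₗ.[ℝ] CliffModule d E where
  domain := (opPow T 2).domain
  toFun := (opPow T 2).toFun
    - (2 * s 0) • (opPow T 1).toFun ∘ₗ Submodule.inclusion (opPow_domain_anti T one_le_two)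
    + (‖s‖ ^ 2) • (opPow T 2).domain.subtype

/-- `B ∈ ℬ(V)` is the inverse of `Q_s[T]`. -/
structure IsQInverse (T : CliffModule d E →ₗ.[ℝ] CliffModule d E) (s : Paravector d)
    (B : CliffModule d E →L[ℝ] CliffModule d E) : Prop where
  map_rightMul : ∀ (a : Cliff d) (v : CliffModule d E), B (rightMul a v) = rightMul a (B v)
  right_inv : ∀ v, ∃ h : B v ∈ (Qop T s).domain, Qop T s ⟨B v, h⟩ = v
  left_inv : ∀ v : (Qop T s).domain, B (Qop T s v) = v

/-- The `S`-resolvent set. -/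
def resolventSetS (T : CliffModule d E →ₗ.[ℝ] CliffModule d E) : Set (Paravector d) :=
  {s | ∃ B, IsQInverse T s B}

/-- The `S`-spectrum. -/
def spectrumS (T : CliffModule d E →ₗ.[ℝ] CliffModule d E) : Set (Paravector d) :=
  (resolventSetS T)ᶜ

open Classical in
/-- `Q_s[T]⁻¹` for `s` in the `S`-resolvent set (and `0` elsewhere). -/
def Qinv (T : CliffModule d E →ₗ.[ℝ] CliffModule d E) (s : Paravector d) :
    CliffModule d E →L[ℝ] CliffModule d E :=
  if h : ∃ B, IsQInverse T s B then h.choose else 0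

/-- `A` is the operator `Q_s[T]⁻¹ s̄ - T Q_s[T]⁻¹`. -/
def IsLeftResolvent (T : CliffModule d E →ₗ.[ℝ] CliffModule d E) (s : Paravector d)
    (A : CliffModule d E →L[ℝ] CliffModule d E) : Prop :=
  ∀ v, ∃ h : Qinv T s v ∈ T.domain,
    A v = Qinv T s (leftMul (conj s).toCliff v) - T ⟨Qinv T s v, h⟩

open Classical in
/-- The left `S`-resolvent `S_L⁻¹(s,T) = Q_s[T]⁻¹ s̄ - T Q_s[T]⁻¹` as a bounded operator, for `s`
in the `S`-resolvent set of `T ∈ 𝒦(V)`. For such `s` the operator on the right-hand side is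
everywhere defined, and bounded by the closed graph theorem. -/
def leftResolvent (T : CliffModule d E →ₗ.[ℝ] CliffModule d E) (s : Paravector d) :
    CliffModule d E →L[ℝ] CliffModule d E :=
  if h : ∃ A, IsLeftResolvent T s A then h.choose else 0

/-- Bisectorial operators of angle `ω`. -/
structure IsBisectorial (T : CliffModule d E →ₗ.[ℝ] CliffModule d E) (ω : ℝ) : Prop where
  isClosedOperator : IsClosedOperator T
  spectrum_subset : spectrumS T ⊆ closure (doubleSector d ω)
  resolvent_bound : ∀ φ ∈ Set.Ioo ω (Real.pi / 2), ∃ C : ℝ, 0 ≤ C ∧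
    ∀ s : Paravector d, s ∉ doubleSector d φ → s ≠ 0 → ‖leftResolvent T s‖ ≤ C / ‖s‖

/-- The integral `∫ S_L⁻¹(s,T) ds_J f(s)` along the ray `s = te^{Jα}`, `0 < t < ∞`, where
`ds_J = ds / J = e^{Jα} (-J) dt`. -/
def rayIntegral (T : CliffModule d E →ₗ.[ℝ] CliffModule d E) (f : Paravector d → Cliff d)
    (J : Paravector d) (α : ℝ) : CliffModule d E →L[ℝ] CliffModule d E :=
  ∫ t in Set.Ioi (0 : ℝ), leftResolvent T (polar J t α) ∘L
    leftMul ((polar J 1 α).toCliff * (-J.toCliff) * f (polar J t α))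

/-- The operator `f(T) = (1/2π) ∫_{∂D_φ ∩ ℂ_J} S_L⁻¹(s,T) ds_J f(s)`. The positively oriented
boundary of `D_φ ∩ ℂ_J` comes in from infinity along the rays of angle `φ` and `π + φ` and goes out
to infinity along those of angle `-φ` and `π - φ`. -/
def omegaCalculus (T : CliffModule d E →ₗ.[ℝ] CliffModule d E) (f : Paravector d → Cliff d)
    (φ : ℝ) (J : Paravector d) : CliffModule d E →L[ℝ] CliffModule d E :=
  (1 / (2 * Real.pi)) •
    (rayIntegral T f J (-φ) - rayIntegral T f J φ
      + rayIntegral T f J (Real.pi - φ) - rayIntegral T f J (Real.pi + φ))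

end CliffModule

end

/-! ### Left multiplication on the Clifford module, and arithmetic of paravectors. -/

noncomputable section

namespace CliffModule

variable {d : ℕ} {E : Type*} [NormedAddCommGroup E] [NormedSpace ℝ E]

/-! Fix `J`. Left multiplication by x + Jy embeds ℂ into the bounded operators by a real algebra
homomorphism ψ. On this slice, f becomes an operator-valued F whose derivative has the form h ↦ ψ(h)
b (the Cauchy–Riemann equations), and the resolvent A(z) = S_L⁻¹(x + Jy, T) has a derivative of the
form h ↦ a ψ(h). `T` need not commute with left multiplication, so the sides matter, but in A(z)
(dz/J) F(z) all ψ-factors meet in the middle and commute. Hence the form is closed. In the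
coordinate z = e^w sectors become strips, and Cauchy's theorem rotates rays (`integral_strip`,
`algRayIntegral_eq`).

The algebraic core is the resolvent equation T A(z) u = A(z) ψ(z) u - u
(`IsBisectorial.mem_graph_sliceResolvent`). Since `T` is closed, it can be applied under the
integral: T f(T) equals (zf)(T) minus (1/2π) ∫ (dz/J) f. The last integral contains no resolvent, so
the two rays bounding each sector can be rotated into each other through the sector, and it vanishes
(`mem_graph_planeCalculus`). This needs f = z⁻¹(zf) to be integrable against dt on rays, which holds
if zf lies in the class.

All z^k f with k ≤ n lie in the class, because |z|^k ≤ C(1 + |p(z)|) (`exists_norm_pow_le`,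
`PlaneSHL0.pow_mul`). Iteration gives T^k f(T) = (z^k f)(T) for k ≤ n, and summation against the
coefficients of p gives the claim, with one φ and one `J` for both operators.

Independence of φ and `J` remains (`omegaCalculus_congr`). Rotating rays between the angles ω and θ
handles φ. For `J`, the contributions of `J` and `-J` are added: Q_s[T] depends only on s₀ and |s|,
f = f₀ + J f₁, and the terms odd in `J` cancel (`slice_integrand_add_neg`). -/

theorem amplify_apply (R : Cliff d →ₗ[ℝ] Cliff d) (v : CliffModule d E) (C : Finset (Fin d)) :
    amplify R v C = ∑ A, (Cliff.basis d).repr (R (Cliff.basisVec A)) C • v A := by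
  simp [amplify]

/-- In the basis (e_A) this is the product of the two coordinate matrices. It makes `leftMul`
multiplicative. -/
theorem amplify_comp (R S : Cliff d →ₗ[ℝ] Cliff d) :
    amplify (E := E) (R ∘ₗ S) = amplify R * amplify S := by
  ext v C
  rw [mul_apply_eq_comp, amplify_apply, amplify_apply]
  simp only [amplify_apply, Finset.smul_sum, smul_smul]
  rw [Finset.sum_comm]
  refine Finset.sum_congr rfl fun B _ => ?_
  rw [← Finset.sum_smul]
  congr 1
  have h := (Cliff.basis d).sum_repr (S (Cliff.basisVec B))
  have h2 : R (S (Cliff.basisVec B)) = ∑ A, (Cliff.basis d).repr (S (Cliff.basisVec B)) A •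
      R (Cliff.basisVec A) := by
    conv_lhs => rw [← h]
    simp [Cliff.basis]
  rw [LinearMap.comp_apply, h2]
  simp [Finsupp.finsetSum_apply, mul_comm]

theorem amplify_id : amplify (E := E) (LinearMap.id : Cliff d →ₗ[ℝ] Cliff d) = 1 := by
  ext v C
  rw [amplify_apply]
  have h : ∀ A : Finset (Fin d), (Cliff.basis d).repr (Cliff.basisVec A) C
      = if A = C then 1 else 0 := by
    intro A
    have : Cliff.basisVec A = Cliff.basis d A := by simp [Cliff.basis]
    rw [this, Module.Basis.repr_self, Finsupp.single_apply]
  simp [h]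

/-- Left multiplication as an algebra homomorphism from the Clifford algebra to `ℬ(V)`. -/
def leftMulHom (d : ℕ) (E : Type*) [NormedAddCommGroup E] [NormedSpace ℝ E] :
    Cliff d →ₐ[ℝ] (CliffModule d E →L[ℝ] CliffModule d E) :=
  AlgHom.ofLinearMap
    { toFun := leftMul
      map_add' := fun s t => by
        ext v C
        simp [leftMul, amplify_apply, add_mul, add_smul, Finset.sum_add_distrib]
      map_smul' := fun a s => by
        ext v C
        simp [leftMul, amplify_apply, Finset.smul_sum, smul_smul] }
    (by
      change leftMul 1 = 1
      rw [leftMul, LinearMap.mulLeft_one, amplify_id])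
    (fun s t => by
      change leftMul (s * t) = leftMul s * leftMul t
      rw [leftMul, LinearMap.mulLeft_mul, amplify_comp]; rfl)

@[simp]
theorem leftMulHom_apply (s : Cliff d) : leftMulHom d E s = leftMul s := rfl

/-- Makes every linear map out of the Clifford algebra continuous, in particular `leftMul`. -/
instance : FiniteDimensional ℝ (Cliff d) := (Cliff.basis d).finiteDimensional_of_finite

/-- Left multiplication as a bounded linear map from the Clifford algebra to `ℬ(V)`. -/
def leftMulCLM (d : ℕ) (E : Type*) [NormedAddCommGroup E] [NormedSpace ℝ E] :
    Cliff d →L[ℝ] (CliffModule d E →L[ℝ] CliffModule d E) :=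
  LinearMap.toContinuousLinearMap (leftMulHom d E).toLinearMap

end CliffModule

namespace Paravector

variable {d : ℕ}

/-- A purely imaginary paravector is a Clifford vector, whose square is the value of the quadratic
form, -|J|². -/
theorem toCliff_mul_self {J : Paravector d} (hJ : J ∈ unitSphere d) :
    J.toCliff * J.toCliff = -1 := by
  have h1 : J.toCliff = CliffordAlgebra.ι (cliffordForm d) (fun i => J i.succ) := by
    rw [toCliff, hJ.1, map_zero, zero_add]
    simp only [Cliff.unit, ← map_smul, ← map_sum]
    congr 1
    ext k
    simp [Finset.sum_apply, Pi.single_apply]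
  have h2 : cliffordForm d (fun i => J i.succ) = -1 := by
    have h3 : ‖J‖ ^ 2 = 1 := by rw [hJ.2]; norm_num
    rw [EuclideanSpace.norm_sq_eq, Fin.sum_univ_succ, hJ.1] at h3
    simp only [Real.norm_eq_abs, sq_abs] at h3
    simp only [cliffordForm, QuadraticMap.weightedSumSquares_apply, smul_eq_mul, neg_mul, one_mul,
      Finset.sum_neg_distrib]
    simp only [← sq]
    linarith
  rw [h1, CliffordAlgebra.ι_sq_scalar, h2]
  simp

theorem toCliff_add (s t : Paravector d) : (s + t).toCliff = s.toCliff + t.toCliff := by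
  simp only [toCliff, PiLp.add_apply, map_add, add_smul, Finset.sum_add_distrib]
  abel

theorem toCliff_smul (a : ℝ) (s : Paravector d) : (a • s).toCliff = a • s.toCliff := by
  simp [toCliff, mul_add, Finset.mul_sum, mul_assoc, Algebra.smul_def]

theorem toCliff_neg (s : Paravector d) : (-s).toCliff = -s.toCliff := by
  rw [← neg_one_smul ℝ s, toCliff_smul, neg_one_smul]

theorem toCliff_one : (one : Paravector d).toCliff = 1 := by
  simp [toCliff, one]

theorem toCliff_slicePoint (J : Paravector d) (x y : ℝ) :
    (slicePoint J x y).toCliff = algebraMap ℝ _ x + y • J.toCliff := by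
  rw [slicePoint, toCliff_add, toCliff_smul, toCliff_smul, toCliff_one,
    Algebra.algebraMap_eq_smul_one]

theorem slicePoint_zero {J : Paravector d} (hJ : J ∈ unitSphere d) (x y : ℝ) :
    slicePoint J x y 0 = x := by
  simp [slicePoint, one, hJ.1]

theorem norm_sq_slicePoint {J : Paravector d} (hJ : J ∈ unitSphere d) (x y : ℝ) :
    ‖slicePoint J x y‖ ^ 2 = x ^ 2 + y ^ 2 := by
  have h3 : ‖J‖ ^ 2 = 1 := by rw [hJ.2]; norm_num
  rw [EuclideanSpace.norm_sq_eq, Fin.sum_univ_succ] at h3 ⊢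
  simp only [hJ.1, Real.norm_eq_abs, sq_abs, slicePoint, one, PiLp.add_apply, PiLp.smul_apply,
    PiLp.single_apply, smul_eq_mul, if_true, Fin.succ_ne_zero, if_false, mul_zero,
    mul_one, add_zero, zero_add] at h3 ⊢
  simp only [mul_pow, ← Finset.mul_sum]
  linear_combination y ^ 2 * h3

theorem conj_slicePoint {J : Paravector d} (hJ : J ∈ unitSphere d) (x y : ℝ) :
    conj (slicePoint J x y) = slicePoint J x (-y) := by
  rw [conj, slicePoint_zero hJ, slicePoint, slicePoint]
  module

theorem neg_mem_unitSphere {J : Paravector d} (hJ : J ∈ unitSphere d) : -J ∈ unitSphere d := by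
  refine ⟨?_, ?_⟩
  · simp [hJ.1]
  · rw [norm_neg]; exact hJ.2

theorem slicePoint_neg (J : Paravector d) (x y : ℝ) :
    slicePoint (-J) x y = slicePoint J x (-y) := by
  simp [slicePoint]

/-- The point `x + Jy` for the complex number `x + iy`. -/
def ofComplex (J : Paravector d) (z : ℂ) : Paravector d := slicePoint J z.re z.im

theorem norm_ofComplex {J : Paravector d} (hJ : J ∈ unitSphere d) (z : ℂ) :
    ‖ofComplex J z‖ = ‖z‖ := by
  rw [← sq_eq_sq₀ (norm_nonneg _) (norm_nonneg _), ofComplex, norm_sq_slicePoint hJ,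
    Complex.sq_norm, Complex.normSq_apply]
  ring

theorem ofComplex_zero_apply {J : Paravector d} (hJ : J ∈ unitSphere d) (z : ℂ) :
    ofComplex J z 0 = z.re := slicePoint_zero hJ _ _

theorem polar_eq_ofComplex (J : Paravector d) (t φ : ℝ) :
    polar J t φ = ofComplex J (t * Complex.exp (φ * Complex.I)) := by
  rw [polar, ofComplex, Complex.re_ofReal_mul, Complex.im_ofReal_mul, Complex.exp_ofReal_mul_I_re,
    Complex.exp_ofReal_mul_I_im]

theorem polar_neg_neg (J : Paravector d) (t φ : ℝ) : polar (-J) t (-φ) = polar J t φ := by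
  simp [polar, slicePoint_neg]

end Paravector

end

/-! ### Double sectors as cones given by an inequality. -/

noncomputable section

namespace Paravector

variable {d : ℕ}

/-- The unit `J₀` serves for real `s`, whose imaginary part determines no direction; for d = 0 there
would be no unit at all. -/
theorem exists_slicePoint {J₀ : Paravector d} (hJ₀ : J₀ ∈ unitSphere d) (s : Paravector d) :
    ∃ J ∈ unitSphere d, ∃ y : ℝ, 0 ≤ y ∧ s = slicePoint J (s 0) y := by
  set w : Paravector d := s - s 0 • one with hw
  have hw0 : w 0 = 0 := by simp [hw, one]
  by_cases h : w = 0
  · refine ⟨J₀, hJ₀, 0, le_rfl, ?_⟩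
    rw [slicePoint, zero_smul, add_zero]
    exact sub_eq_zero.1 (hw ▸ h)
  · have hn : ‖w‖ ≠ 0 := norm_ne_zero_iff.2 h
    refine ⟨‖w‖⁻¹ • w, ⟨by simp [hw0], ?_⟩, ‖w‖, norm_nonneg _, ?_⟩
    · rw [norm_smul, norm_inv, norm_norm, inv_mul_cancel₀ hn]
    · rw [slicePoint, smul_inv_smul₀ hn, hw]; abel

theorem cos_lt_abs_cos {ω φ : ℝ} (hω : ω ∈ Set.Ioo 0 (Real.pi / 2)) (hφ : φ ∈ angles ω) :
    Real.cos ω < |Real.cos φ| := by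
  have key : ∀ x : ℝ, |x| < ω → Real.cos ω < |Real.cos x| := by
    intro x hx
    have h1 : Real.cos ω < Real.cos |x| :=
      Real.cos_lt_cos_of_nonneg_of_le_pi_div_two (abs_nonneg _) hω.2.le hx
    rw [Real.cos_abs] at h1
    exact h1.trans_le (le_abs_self _)
  rcases hφ with h | h
  · exact key φ (abs_lt.2 h)
  · have := key (φ - Real.pi) (abs_lt.2 ⟨by linarith [h.1], by linarith [h.2]⟩)
    rwa [Real.cos_sub_pi, abs_neg] at this

theorem abs_cos_le {ω φ : ℝ} (hω : ω ∈ Set.Ioo 0 (Real.pi / 2))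
    (hφ : φ ∈ Set.Icc ω (Real.pi - ω)) : |Real.cos φ| ≤ Real.cos ω := by
  rw [abs_le]
  constructor
  · rw [← Real.cos_pi_sub]
    exact Real.cos_le_cos_of_nonneg_of_le_pi (hω.1.trans_le hφ.1).le (by linarith [hω.1]) hφ.2
  · exact Real.cos_le_cos_of_nonneg_of_le_pi hω.1.le (by linarith [hφ.2, hω.1]) hφ.1

/-- The polar description is replaced by a continuous inequality, so that openness, closures and
complements of double sectors can be read off. With y ≥ 0 the angle is the arccosine of s₀/|s|. -/
theorem mem_doubleSector_iff {J₀ : Paravector d} (hJ₀ : J₀ ∈ unitSphere d) {ω : ℝ}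
    (hω : ω ∈ Set.Ioo 0 (Real.pi / 2)) (s : Paravector d) :
    s ∈ doubleSector d ω ↔ Real.cos ω * ‖s‖ < |s 0| := by
  constructor
  · rintro ⟨J, hJ, t, ht, φ, hφ, rfl⟩
    have h1 : ‖polar J t φ‖ = t := by
      rw [polar_eq_ofComplex, norm_ofComplex hJ]
      simp [abs_of_pos ht, Complex.norm_exp]
    rw [h1, polar, slicePoint_zero hJ, abs_mul, abs_of_pos ht, mul_comm]
    exact mul_lt_mul_of_pos_left (cos_lt_abs_cos hω hφ) ht
  · intro h
    obtain ⟨J, hJ, y, hy, hs⟩ := exists_slicePoint hJ₀ s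
    have hn : ‖s‖ ^ 2 = s 0 ^ 2 + y ^ 2 := by
      conv_lhs => rw [hs]
      rw [norm_sq_slicePoint hJ]
    have hs0 : 0 < ‖s‖ := by
      rw [norm_pos_iff]
      rintro rfl
      simp at h
    have hle : |s 0| ≤ ‖s‖ := abs_le_of_sq_le_sq (by nlinarith) hs0.le
    have hle' := abs_le.1 hle
    have hc : Real.cos (Real.arccos (s 0 / ‖s‖)) = s 0 / ‖s‖ := by
      apply Real.cos_arccos
      · rw [le_div_iff₀ hs0]; linarith
      · rw [div_le_iff₀ hs0]; linarith
    refine ⟨J, hJ, ‖s‖, hs0, Real.arccos (s 0 / ‖s‖), ?_, ?_⟩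
    · by_contra hcon
      have hm : Real.arccos (s 0 / ‖s‖) ∈ Set.Icc ω (Real.pi - ω) := by
        constructor
        · by_contra h'
          exact hcon (Or.inl ⟨by linarith [hω.1, Real.arccos_nonneg (s 0 / ‖s‖)], not_le.1 h'⟩)
        · by_contra h'
          exact hcon (Or.inr ⟨not_le.1 h', by linarith [hω.1, Real.arccos_le_pi (s 0 / ‖s‖)]⟩)
      have := abs_cos_le hω hm
      rw [hc, abs_div, abs_of_pos hs0, div_le_iff₀ hs0] at this
      linarith
    · have h1 : ‖s‖ * Real.cos (Real.arccos (s 0 / ‖s‖)) = s 0 := by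
        rw [hc]; field_simp
      have h2 : ‖s‖ * Real.sin (Real.arccos (s 0 / ‖s‖)) = y := by
        rw [← sq_eq_sq₀ (mul_nonneg hs0.le (Real.sin_nonneg_of_nonneg_of_le_pi
          (Real.arccos_nonneg _) (Real.arccos_le_pi _))) hy]
        have h3 := Real.sin_sq_add_cos_sq (Real.arccos (s 0 / ‖s‖))
        have h4 : (‖s‖ * Real.cos (Real.arccos (s 0 / ‖s‖))) ^ 2 = s 0 ^ 2 := by rw [h1]
        linear_combination ‖s‖ ^ 2 * h3 - h4 + hn
      rw [polar, h1, h2]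
      exact hs

theorem le_of_mem_closure_doubleSector {J₀ : Paravector d} (hJ₀ : J₀ ∈ unitSphere d) {ω : ℝ}
    (hω : ω ∈ Set.Ioo 0 (Real.pi / 2)) {s : Paravector d} (hs : s ∈ closure (doubleSector d ω)) :
    Real.cos ω * ‖s‖ ≤ |s 0| := by
  have hc : IsClosed {s : Paravector d | Real.cos ω * ‖s‖ ≤ |s 0|} :=
    isClosed_le (by fun_prop) (by fun_prop)
  exact closure_minimal (fun s hs => ((mem_doubleSector_iff hJ₀ hω s).1 hs).le) hc hs

/-- The complex double sector of half-angle `ω`. -/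
def planeSector (ω : ℝ) : Set ℂ := {z | Real.cos ω * ‖z‖ < |z.re|}

/-- The exterior of the closed complex double sector of half-angle `ω`. -/
def planeExterior (ω : ℝ) : Set ℂ := {z | |z.re| < Real.cos ω * ‖z‖}

theorem isOpen_planeSector (ω : ℝ) : IsOpen (planeSector ω) :=
  isOpen_lt (by fun_prop) (by fun_prop)

theorem isOpen_planeExterior (ω : ℝ) : IsOpen (planeExterior ω) :=
  isOpen_lt (by fun_prop) (by fun_prop)

theorem re_ray (t φ : ℝ) : ((t : ℂ) * Complex.exp (φ * Complex.I)).re = t * Real.cos φ := by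
  rw [Complex.re_ofReal_mul, Complex.exp_ofReal_mul_I_re]

theorem norm_ray {t : ℝ} (ht : 0 < t) (φ : ℝ) : ‖(t : ℂ) * Complex.exp (φ * Complex.I)‖ = t := by
  simp [abs_of_pos ht, Complex.norm_exp]

theorem ray_mem_planeSector {ω t φ : ℝ} (hω : ω ∈ Set.Ioo 0 (Real.pi / 2)) (ht : 0 < t)
    (hφ : φ ∈ angles ω) : (t : ℂ) * Complex.exp (φ * Complex.I) ∈ planeSector ω := by
  rw [planeSector, Set.mem_ofPred_eq, re_ray, norm_ray ht, abs_mul, abs_of_pos ht, mul_comm]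
  exact mul_lt_mul_of_pos_left (cos_lt_abs_cos hω hφ) ht

theorem ofComplex_mem_doubleSector_iff {J : Paravector d} (hJ : J ∈ unitSphere d) {ω : ℝ}
    (hω : ω ∈ Set.Ioo 0 (Real.pi / 2)) (z : ℂ) :
    ofComplex J z ∈ doubleSector d ω ↔ z ∈ planeSector ω := by
  rw [mem_doubleSector_iff hJ hω, norm_ofComplex hJ, ofComplex_zero_apply hJ, planeSector,
    Set.mem_ofPred_eq]

theorem ofComplex_notMem_closure {J : Paravector d} (hJ : J ∈ unitSphere d) {ω : ℝ}
    (hω : ω ∈ Set.Ioo 0 (Real.pi / 2)) {z : ℂ} (hz : z ∈ planeExterior ω) :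
    ofComplex J z ∉ closure (doubleSector d ω) := by
  intro h
  have := le_of_mem_closure_doubleSector hJ hω h
  rw [norm_ofComplex hJ, ofComplex_zero_apply hJ] at this
  exact (not_lt.2 this) hz

end Paravector

end

/-! ### Cauchy's theorem on a strip for one-sided holomorphic functions. -/

noncomputable section

open MeasureTheory Filter Topology

section Cauchy

/-- `H` is integrable only along each horizontal line, with no uniformity, so the vertical integrals
are averaged over x in [k, k + 1]. The average has the same limit `l`. After exchanging the
integrals, the inner one tends to 0 for each v as a piece of a convergent integral, with dominating
constant `M`. -/
theorem eq_zero_of_tendsto_integral {X : Type*} [NormedAddCommGroup X] [NormedSpace ℝ X]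
    [CompleteSpace X] {H : ℝ → ℝ → X} (hc : Continuous (Function.uncurry H)) {M : ℝ}
    (hM : ∀ x v, ‖H x v‖ ≤ M) {a b : ℝ} (hi : ∀ v, Integrable fun x => H x v) {l : X}
    (hl : Tendsto (fun x => ∫ v in a..b, H x v) atTop (𝓝 l)) : l = 0 := by
  set G : ℝ → X := fun x => ∫ v in a..b, H x v with hG
  have hGc : Continuous G := intervalIntegral.continuous_parametric_intervalIntegral_of_continuous'
    hc a b
  have hGb : ∀ x, ‖G x‖ ≤ M * |b - a| := fun x =>
    intervalIntegral.norm_integral_le_of_norm_le_const fun v _ => hM x v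
  have h1 : Tendsto (fun k : ℝ => ∫ u in (0 : ℝ)..1, G (k + u)) atTop
      (𝓝 (∫ _u in (0 : ℝ)..1, l)) := by
    refine intervalIntegral.tendsto_integral_filter_of_dominated_convergence
      (fun _ => M * |b - a|) ?_ ?_ ?_ ?_
    · exact Eventually.of_forall fun k =>
        (by fun_prop : Continuous fun u => G (k + u)).aestronglyMeasurable
    · exact Eventually.of_forall fun k => Eventually.of_forall fun u _ => hGb _
    · exact intervalIntegrable_const
    · exact Eventually.of_forall fun u _ => hl.comp (tendsto_atTop_add_const_right _ u tendsto_id)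
  have h2 : ∀ k : ℝ, ∫ u in (0 : ℝ)..1, G (k + u)
      = ∫ v in a..b, ∫ u in (0 : ℝ)..1, H (k + u) v := by
    intro k
    refine intervalIntegral_intervalIntegral_swap (F := fun u v => H (k + u) v) ?_
    have : Continuous (Function.uncurry fun u v => H (k + u) v) :=
      hc.comp (by fun_prop : Continuous fun p : ℝ × ℝ => (k + p.1, p.2))
    refine (this.continuousOn.integrableOn_compact
      ((isCompact_uIcc (a := (0 : ℝ)) (b := 1)).prod (isCompact_uIcc (a := a) (b := b)))).mono_set ?_
    exact Set.prod_mono Set.uIoc_subset_uIcc Set.uIoc_subset_uIcc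
  have h3 : Tendsto (fun k : ℝ => ∫ v in a..b, ∫ u in (0 : ℝ)..1, H (k + u) v) atTop
      (𝓝 (∫ _v in a..b, (0 : X))) := by
    refine intervalIntegral.tendsto_integral_filter_of_dominated_convergence
      (fun _ => M) ?_ ?_ ?_ ?_
    · refine Eventually.of_forall fun k => Continuous.aestronglyMeasurable ?_
      exact intervalIntegral.continuous_parametric_intervalIntegral_of_continuous'
        (f := fun v u => H (k + u) v)
        (hc.comp (by fun_prop : Continuous fun p : ℝ × ℝ => (k + p.2, p.1))) 0 1
    · refine Eventually.of_forall fun k => Eventually.of_forall fun v _ => ?_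
      refine (intervalIntegral.norm_integral_le_of_norm_le_const fun u _ => hM (k + u) v).trans ?_
      simp
    · exact intervalIntegrable_const
    · refine Eventually.of_forall fun v _ => ?_
      have e1 := intervalIntegral_tendsto_integral_Ioi 0 ((hi v).integrableOn (s := Set.Ioi 0))
        tendsto_id
      have e2 := intervalIntegral_tendsto_integral_Ioi 0 ((hi v).integrableOn (s := Set.Ioi 0))
        (tendsto_atTop_add_const_right atTop (1 : ℝ) tendsto_id)
      have e3 := e2.sub e1
      rw [sub_self] at e3
      refine e3.congr fun k => ?_
      rw [intervalIntegral.integral_comp_add_left (fun x => H x v) k, add_zero]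
      exact intervalIntegral.integral_interval_sub_left ((hi v).intervalIntegrable)
        ((hi v).intervalIntegrable)
  simp only [h2] at h1
  have := tendsto_nhds_unique h1 h3
  simpa using this

variable {𝔅 : Type*} [NormedRing 𝔅] [NormedAlgebra ℝ 𝔅]

/-- Right holomorphic functions with values in a real Banach algebra containing a copy of `ℂ`. -/
def RightHolAt (ψ : ℂ →ₐ[ℝ] 𝔅) (A : ℂ → 𝔅) (z : ℂ) : Prop :=
  ∃ (a : 𝔅) (A' : ℂ →L[ℝ] 𝔅), HasFDerivAt A A' z ∧ ∀ h, A' h = a * ψ h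

/-- Left holomorphic functions with values in a real Banach algebra containing a copy of `ℂ`. -/
def LeftHolAt (ψ : ℂ →ₐ[ℝ] 𝔅) (F : ℂ → 𝔅) (z : ℂ) : Prop :=
  ∃ (b : 𝔅) (F' : ℂ →L[ℝ] 𝔅), HasFDerivAt F F' z ∧ ∀ h, F' h = ψ h * b

/-- The inclusion of `ℂ` as a bounded linear map. -/
def algHomCLM (ψ : ℂ →ₐ[ℝ] 𝔅) : ℂ →L[ℝ] 𝔅 := LinearMap.toContinuousLinearMap ψ.toLinearMap

@[simp]
theorem algHomCLM_apply (ψ : ℂ →ₐ[ℝ] 𝔅) (z : ℂ) : algHomCLM ψ z = ψ z := rfl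

theorem norm_complexAlgHom_le (ψ : ℂ →ₐ[ℝ] 𝔅) (z : ℂ) : ‖ψ z‖ ≤ ‖algHomCLM ψ‖ * ‖z‖ :=
  (algHomCLM ψ).le_opNorm z

theorem complexAlgHom_comm (ψ : ℂ →ₐ[ℝ] 𝔅) (z w : ℂ) : ψ z * ψ w = ψ w * ψ z := by
  rw [← map_mul, mul_comm, map_mul]

theorem complexAlgHom_eq (ψ : ℂ →ₐ[ℝ] 𝔅) (w : ℂ) :
    ψ w = w.re • (1 : 𝔅) + w.im • ψ Complex.I := by
  conv_lhs => rw [← Complex.re_add_im w]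
  rw [map_add, map_mul, ← Complex.coe_algebraMap, AlgHom.commutes, AlgHom.commutes,
    ← Algebra.smul_def, Algebra.algebraMap_eq_smul_one]

theorem hasFDerivAt_complexAlgHom_comp (ψ : ℂ →ₐ[ℝ] 𝔅) {g : ℂ → ℂ} {g' z : ℂ}
    (hg : HasDerivAt g g' z) :
    ∃ G' : ℂ →L[ℝ] 𝔅, HasFDerivAt (fun z => ψ (g z)) G' z ∧ ∀ h, G' h = ψ g' * ψ h := by
  refine ⟨_, (algHomCLM ψ).hasFDerivAt.comp z (hg.hasFDerivAt.restrictScalars ℝ), fun h => ?_⟩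
  simp [mul_comm]

variable {ψ : ℂ →ₐ[ℝ] 𝔅} {A F : ℂ → 𝔅} {z : ℂ}

theorem RightHolAt.continuousAt (h : RightHolAt ψ A z) : ContinuousAt A z := by
  obtain ⟨a, A', h, -⟩ := h
  exact h.continuousAt

theorem LeftHolAt.continuousAt (h : LeftHolAt ψ F z) : ContinuousAt F z := by
  obtain ⟨a, A', h, -⟩ := h
  exact h.continuousAt

theorem rightHolAt_const (c : 𝔅) : RightHolAt ψ (fun _ => c) z :=
  ⟨0, 0, hasFDerivAt_const _ _, by simp⟩

theorem RightHolAt.comp {g : ℂ → ℂ} {g' : ℂ} (h : RightHolAt ψ A (g z)) (hg : HasDerivAt g g' z) :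
    RightHolAt ψ (fun z => A (g z)) z := by
  obtain ⟨a, A', hA, ha⟩ := h
  refine ⟨a * ψ g', _, hA.comp z (hg.hasFDerivAt.restrictScalars ℝ), fun h => ?_⟩
  simp [ha, mul_assoc, complexAlgHom_comm ψ h]

theorem LeftHolAt.comp {g : ℂ → ℂ} {g' : ℂ} (h : LeftHolAt ψ F (g z)) (hg : HasDerivAt g g' z) :
    LeftHolAt ψ (fun z => F (g z)) z := by
  obtain ⟨b, F', hF, hb⟩ := h
  refine ⟨ψ g' * b, _, hF.comp z (hg.hasFDerivAt.restrictScalars ℝ), fun h => ?_⟩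
  simp [hb, mul_assoc]

theorem RightHolAt.mul_right {g : ℂ → ℂ} {g' : ℂ} (h : RightHolAt ψ A z)
    (hg : HasDerivAt g g' z) : RightHolAt ψ (fun z => A z * ψ (g z)) z := by
  obtain ⟨a, A', hA, ha⟩ := h
  obtain ⟨G', hG, hG'⟩ := hasFDerivAt_complexAlgHom_comp ψ hg
  refine ⟨A z * ψ g' + a * ψ (g z), _, hA.mul' hG, fun h => ?_⟩
  simp [ha, hG', add_mul, mul_assoc, complexAlgHom_comm ψ h]

theorem LeftHolAt.mul_left {g : ℂ → ℂ} {g' : ℂ} (h : LeftHolAt ψ F z)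
    (hg : HasDerivAt g g' z) : LeftHolAt ψ (fun z => ψ (g z) * F z) z := by
  obtain ⟨b, F', hF, hb⟩ := h
  obtain ⟨G', hG, hG'⟩ := hasFDerivAt_complexAlgHom_comp ψ hg
  refine ⟨ψ g' * F z + ψ (g z) * b, _, hG.mul' hF, fun h => ?_⟩
  simp [hb, hG', mul_add, ← mul_assoc, complexAlgHom_comm ψ h]
  abel

/-- This says that A (dz/i) F is closed: with A' = aψ and F' = ψb, both partial derivatives equal Ab
+ aF, since the factors ψ(i) meet -ψ(i) in the middle. -/
theorem exists_hasFDerivAt_mul (hA : RightHolAt ψ A z) (hF : LeftHolAt ψ F z) :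
    ∃ (c : 𝔅) (P' Q' : ℂ →L[ℝ] 𝔅), HasFDerivAt (fun z => A z * F z) Q' z ∧
      HasFDerivAt (fun z => A z * -ψ Complex.I * F z) P' z ∧ Q' 1 = c ∧ P' Complex.I = c := by
  have hI : ψ Complex.I * ψ Complex.I = -1 := by rw [← map_mul, Complex.I_mul_I, map_neg, map_one]
  obtain ⟨a, A', hA, ha⟩ := hA
  obtain ⟨b, F', hF, hb⟩ := hF
  refine ⟨A z * b + a * F z, _, _, hA.mul' hF, (hA.mul_const' (-ψ Complex.I)).mul' hF, ?_, ?_⟩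
  · simp [ha, hb]
  · simp only [add_apply, smul_apply, ha, hb, smul_eq_mul,
      MulOpposite.smul_eq_mul_unop, MulOpposite.unop_op]
    have e1 : A z * -ψ Complex.I * (ψ Complex.I * b) = A z * -(ψ Complex.I * ψ Complex.I) * b := by
      noncomm_ring
    have e2 : a * ψ Complex.I * -ψ Complex.I * F z = a * -(ψ Complex.I * ψ Complex.I) * F z := by
      noncomm_ring
    rw [e1, e2, hI]
    simp

theorem integral_rectangle {a b r R : ℝ}
    (hA : ∀ w : ℂ, w.im ∈ Set.uIcc a b → RightHolAt ψ A w)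
    (hF : ∀ w : ℂ, w.im ∈ Set.uIcc a b → LeftHolAt ψ F w) :
    (∫ u in r..R, A (u + b * Complex.I) * -ψ Complex.I * F (u + b * Complex.I))
      - (∫ u in r..R, A (u + a * Complex.I) * -ψ Complex.I * F (u + a * Complex.I))
    = (∫ v in a..b, A (R + v * Complex.I) * F (R + v * Complex.I))
      - ∫ v in a..b, A (r + v * Complex.I) * F (r + v * Complex.I) := by
  set e : ℝ × ℝ →L[ℝ] ℂ := Complex.equivRealProdCLM.symm.toContinuousLinearMap with he
  have hev : ∀ u v : ℝ, e (u, v) = u + v * Complex.I := by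
    intro u v
    apply Complex.ext <;> simp [he]
  have him : ∀ x : ℝ × ℝ, (e x).im = x.2 := by
    intro x; simp [he]
  have key := fun w (hw : w.im ∈ Set.uIcc a b) => exists_hasFDerivAt_mul (hA w hw) (hF w hw)
  choose! c P' Q' hQ hP hQc hPc using key
  have hQe : ∀ x : ℝ × ℝ, x.2 ∈ Set.uIcc a b →
      HasFDerivAt (fun x => A (e x) * F (e x)) (Q' (e x) ∘L e) x :=
    fun x hx => (hQ (e x) (by rwa [him])).comp x e.hasFDerivAt
  have hPe : ∀ x : ℝ × ℝ, x.2 ∈ Set.uIcc a b →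
      HasFDerivAt (fun x => -(A (e x) * -ψ Complex.I * F (e x))) (-(P' (e x) ∘L e)) x :=
    fun x hx => ((hP (e x) (by rwa [him])).comp x e.hasFDerivAt).neg
  have hsum : ∀ x : ℝ × ℝ, x.2 ∈ Set.uIcc a b →
      (Q' (e x) ∘L e) (1, 0) + (-(P' (e x) ∘L e)) (0, 1) = 0 := by
    intro x hx
    have e1 : e (1, 0) = 1 := by rw [hev]; simp
    have e2 : e (0, 1) = Complex.I := by rw [hev]; simp
    simp [e1, e2, hQc (e x) (by rwa [him]), hPc (e x) (by rwa [him])]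
  have h := integral2_divergence_prod_of_hasFDerivAt (fun x => A (e x) * F (e x))
    (fun x => -(A (e x) * -ψ Complex.I * F (e x))) (fun x => Q' (e x) ∘L e)
    (fun x => -(P' (e x) ∘L e)) r a R b
    (fun x hx => (hQe x hx.2).continuousAt.continuousWithinAt)
    (fun x hx => (hPe x hx.2).continuousAt.continuousWithinAt)
    (fun x hx => hQe x (Set.Ioo_subset_Icc_self hx.2))
    (fun x hx => hPe x (Set.Ioo_subset_Icc_self hx.2))
    ((integrableOn_zero (ε' := 𝔅)).congr_fun (fun x hx => (hsum x hx.2).symm)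
      (measurableSet_uIcc.prod measurableSet_uIcc))
  have h0 : (∫ x in r..R, ∫ y in a..b,
      ((Q' (e (x, y)) ∘L e) (1, 0) + (-(P' (e (x, y)) ∘L e)) (0, 1))) = 0 := by
    have : ∀ x : ℝ, (∫ y in a..b,
        ((Q' (e (x, y)) ∘L e) (1, 0) + (-(P' (e (x, y)) ∘L e)) (0, 1))) = 0 := by
      intro x
      rw [intervalIntegral.integral_congr (g := fun _ => (0 : 𝔅)) (fun y hy => hsum (x, y) hy)]
      simp
    simp only [this, intervalIntegral.integral_zero]
  rw [h0] at h
  simp only [intervalIntegral.integral_neg, hev] at h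
  have gen : ∀ p q g k : 𝔅, 0 = -p - -q + g - k → p - q = g - k := by
    intro p q g k h
    have h' : k = -p - -q + g := (sub_eq_zero.1 h.symm).symm
    rw [h']; abel
  exact gen _ _ _ _ h

variable [CompleteSpace 𝔅]

/-- Horizontal integrals over [r, R] differ by the difference of the vertical sides G(R) and G(r).
Integrability makes G converge at both ends, and the averaging lemma forces both limits to be 0. -/
theorem integral_strip {a b M : ℝ} (hab : a ≤ b)
    (hA : ∀ w : ℂ, w.im ∈ Set.Icc a b → RightHolAt ψ A w)
    (hF : ∀ w : ℂ, w.im ∈ Set.Icc a b → LeftHolAt ψ F w)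
    (hM : ∀ w : ℂ, w.im ∈ Set.Icc a b → ‖A w‖ * ‖F w‖ ≤ M)
    (hi : ∀ v ∈ Set.Icc a b, Integrable fun u : ℝ =>
      ‖A (u + v * Complex.I)‖ * ‖F (u + v * Complex.I)‖) :
    ∫ u : ℝ, A (u + b * Complex.I) * -ψ Complex.I * F (u + b * Complex.I)
      = ∫ u : ℝ, A (u + a * Complex.I) * -ψ Complex.I * F (u + a * Complex.I) := by
  -- Clamping the height to [a, b] makes the integrand continuous and bounded on the whole plane.
  set c : ℝ → ℝ := fun v => max a (min v b) with hc
  have hcm : ∀ v, c v ∈ Set.Icc a b := fun v => ⟨le_max_left _ _, max_le hab (min_le_right _ _)⟩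
  have hcv : ∀ v ∈ Set.Icc a b, c v = v := fun v hv => by simp [hc, hv.1, hv.2]
  have hcc : Continuous c := by fun_prop
  have him : ∀ u v : ℝ, ((u : ℂ) + v * Complex.I).im = v := by intro u v; simp
  have hcont : ∀ G : ℂ → 𝔅, (∀ w : ℂ, w.im ∈ Set.Icc a b → ContinuousAt G w) →
      Continuous fun p : ℝ × ℝ => G (p.1 + c p.2 * Complex.I) := by
    intro G hG
    rw [continuous_iff_continuousAt]
    intro p
    refine ContinuousAt.comp (g := G) (hG _ ?_) (Continuous.continuousAt (by fun_prop))
    rw [him]; exact hcm _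
  have hAc := hcont A fun w hw => (hA w hw).continuousAt
  have hFc := hcont F fun w hw => (hF w hw).continuousAt
  set H : ℝ → ℝ → 𝔅 := fun x v => A (x + c v * Complex.I) * F (x + c v * Complex.I) with hH
  have hHc : Continuous (Function.uncurry H) := hAc.mul hFc
  have hHM : ∀ x v, ‖H x v‖ ≤ M := fun x v =>
    (norm_mul_le _ _).trans (hM _ (by rw [him]; exact hcm v))
  have hHi : ∀ v, Integrable fun x => H x v := fun v =>
    (hi (c v) (hcm v)).mono'
      (hHc.comp (by fun_prop : Continuous fun x : ℝ => (x, v))).aestronglyMeasurable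
      (Eventually.of_forall fun x => norm_mul_le _ _)
  have hPi : ∀ v ∈ Set.Icc a b, Integrable fun u : ℝ =>
      A (u + v * Complex.I) * -ψ Complex.I * F (u + v * Complex.I) := by
    intro v hv
    refine ((hi v hv).mul_const ‖ψ Complex.I‖).mono' ?_ (Eventually.of_forall fun x => ?_)
    · have h1 := hAc.comp (by fun_prop : Continuous fun x : ℝ => (x, v))
      have h2 := hFc.comp (by fun_prop : Continuous fun x : ℝ => (x, v))
      simp only [Function.comp_def, hcv v hv] at h1 h2
      exact ((h1.mul continuous_const).mul h2).aestronglyMeasurable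
    · refine (norm_mul_le _ _).trans ?_
      refine (mul_le_mul_of_nonneg_right (norm_mul_le _ _) (norm_nonneg _)).trans (le_of_eq ?_)
      rw [norm_neg]; ring
  have ha : a ∈ Set.Icc a b := ⟨le_rfl, hab⟩
  have hb : b ∈ Set.Icc a b := ⟨hab, le_rfl⟩
  set G : ℝ → 𝔅 := fun x => ∫ v in a..b, H x v with hG
  have hrect : ∀ r R : ℝ, (∫ u in r..R, (A (u + b * Complex.I) * -ψ Complex.I *
      F (u + b * Complex.I) - A (u + a * Complex.I) * -ψ Complex.I * F (u + a * Complex.I)))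
      = G R - G r := by
    intro r R
    rw [intervalIntegral.integral_sub (hPi b hb).intervalIntegrable (hPi a ha).intervalIntegrable,
      integral_rectangle (by rwa [Set.uIcc_of_le hab]) (by rwa [Set.uIcc_of_le hab])]
    congr 1
    · refine intervalIntegral.integral_congr fun v hv => ?_
      rw [Set.uIcc_of_le hab] at hv
      simp only [hH, hcv v hv]
    · refine intervalIntegral.integral_congr fun v hv => ?_
      rw [Set.uIcc_of_le hab] at hv
      simp only [hH, hcv v hv]
  have hDi := (hPi b hb).sub (hPi a ha)
  have h1 := intervalIntegral_tendsto_integral_Ioi 0 (hDi.integrableOn (s := Set.Ioi 0)) tendsto_id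
  have h2 := intervalIntegral_tendsto_integral_Iic 0 (hDi.integrableOn (s := Set.Iic 0))
    tendsto_neg_atTop_atBot
  simp only [Pi.sub_apply, hrect, id] at h1 h2
  have h3 := eq_zero_of_tendsto_integral hHc hHM hHi
    ((h1.add_const (G 0)).congr fun x => sub_add_cancel _ _)
  -- The left end is the right end after the reflection x ↦ -x.
  have h4 := eq_zero_of_tendsto_integral (H := fun x v => H (-x) v)
    (hHc.comp (by fun_prop : Continuous fun p : ℝ × ℝ => (-p.1, p.2))) (fun x v => hHM _ _)
    (fun v => (hHi v).comp_neg)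
    ((h2.const_sub (G 0)).congr fun x => sub_sub_cancel _ _)
  have h5 := intervalIntegral.integral_Iic_add_Ioi (hDi.integrableOn (s := Set.Iic 0))
    (hDi.integrableOn (s := Set.Ioi 0))
  simp only [Pi.sub_apply] at h5
  rw [← sub_eq_zero, ← integral_sub (hPi b hb) (hPi a ha), ← h5, ← sub_eq_zero.1 h4,
    add_comm, h3]

end Cauchy

end

/-! ### Rotation of rays by the substitution z = e^w. -/

noncomputable section

open MeasureTheory Filter Topology

section Sector

theorem integral_Ioi_eq_integral_exp {X : Type*} [NormedAddCommGroup X] [NormedSpace ℝ X]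
    (g : ℝ → X) : ∫ t in Set.Ioi (0 : ℝ), g t = ∫ u, Real.exp u • g (Real.exp u) := by
  have h := integral_image_eq_integral_abs_deriv_smul (s := Set.univ) MeasurableSet.univ
    (fun x _ => (Real.hasDerivAt_exp x).hasDerivWithinAt) Real.exp_injective.injOn g
  simpa [Real.range_exp, abs_of_pos (Real.exp_pos _)] using h

theorem integrableOn_Ioi_iff_integrable_exp {X : Type*} [NormedAddCommGroup X] [NormedSpace ℝ X]
    (g : ℝ → X) : IntegrableOn g (Set.Ioi (0 : ℝ)) ↔
      Integrable fun u => Real.exp u • g (Real.exp u) := by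
  have h := integrableOn_image_iff_integrableOn_abs_deriv_smul (s := Set.univ) MeasurableSet.univ
    (fun x _ => (Real.hasDerivAt_exp x).hasDerivWithinAt) Real.exp_injective.injOn g
  simpa [Real.range_exp, abs_of_pos (Real.exp_pos _)] using h

variable {𝔅 : Type*} [NormedRing 𝔅] [NormedAlgebra ℝ 𝔅]

/-- The point `te^{iα}`. -/
def rayPoint (α t : ℝ) : ℂ := t * Complex.exp (α * Complex.I)

theorem continuous_rayPoint (α : ℝ) : Continuous (rayPoint α) := by
  unfold rayPoint; fun_prop

theorem exp_eq_rayPoint (w : ℂ) : Complex.exp w = rayPoint w.im (Real.exp w.re) := by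
  rw [rayPoint, Complex.ofReal_exp, ← Complex.exp_add, Complex.re_add_im]

theorem norm_rayPoint {t : ℝ} (ht : 0 < t) (α : ℝ) : ‖rayPoint α t‖ = t :=
  Paravector.norm_ray ht α

theorem rayPoint_eq_smul (α t : ℝ) : rayPoint α t = t • rayPoint α 1 := by
  simp [rayPoint]

/-- The integrand of the integral `∫ A(z) dz/i F(z)` along the ray of angle `α`. -/
def rayIntegrand (ψ : ℂ →ₐ[ℝ] 𝔅) (A F : ℂ → 𝔅) (α t : ℝ) : 𝔅 :=
  A (rayPoint α t) * (ψ (rayPoint α 1) * -ψ Complex.I * F (rayPoint α t))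

/-- The integral `∫ A(z) dz/i F(z)` along the ray of angle `α`. -/
def algRayIntegral (ψ : ℂ →ₐ[ℝ] 𝔅) (A F : ℂ → 𝔅) (α : ℝ) : 𝔅 :=
  ∫ t in Set.Ioi (0 : ℝ), rayIntegrand ψ A F α t

variable {ψ : ℂ →ₐ[ℝ] 𝔅} {A F : ℂ → 𝔅}

theorem integrableOn_rayIntegrand {α : ℝ} (hA : ∀ t, 0 < t → ContinuousAt A (rayPoint α t))
    (hF : ∀ t, 0 < t → ContinuousAt F (rayPoint α t))
    (hi : IntegrableOn (fun t => ‖A (rayPoint α t)‖ * ‖F (rayPoint α t)‖) (Set.Ioi 0)) :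
    IntegrableOn (rayIntegrand ψ A F α) (Set.Ioi 0) := by
  refine (hi.mul_const ‖ψ (rayPoint α 1) * -ψ Complex.I‖).mono' ?_ (Eventually.of_forall fun t => ?_)
  · refine ContinuousOn.aestronglyMeasurable (fun t ht => ContinuousAt.continuousWithinAt ?_)
      measurableSet_Ioi
    have h1 := ContinuousAt.comp (f := rayPoint α) (hA t ht) (continuous_rayPoint α).continuousAt
    have h2 := ContinuousAt.comp (f := rayPoint α) (hF t ht) (continuous_rayPoint α).continuousAt
    exact h1.mul (continuousAt_const.mul h2)
  · refine (norm_mul_le _ _).trans ?_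
    refine (mul_le_mul_of_nonneg_left (norm_mul_le _ _) (norm_nonneg _)).trans (le_of_eq ?_)
    ring

variable [CompleteSpace 𝔅]

/-- Under z = e^w the ray of angle v becomes the line Im w = v, and A(z) dz becomes A(e^w) ψ(e^w)
dw, which is again right holomorphic in w. The factor `t` in the bound is |dz/dw|. -/
theorem algRayIntegral_eq {a b M : ℝ} (hab : a ≤ b)
    (hA : ∀ v ∈ Set.Icc a b, ∀ t, 0 < t → RightHolAt ψ A (rayPoint v t))
    (hF : ∀ v ∈ Set.Icc a b, ∀ t, 0 < t → LeftHolAt ψ F (rayPoint v t))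
    (hM : ∀ v ∈ Set.Icc a b, ∀ t, 0 < t → t * (‖A (rayPoint v t)‖ * ‖F (rayPoint v t)‖) ≤ M)
    (hi : ∀ v ∈ Set.Icc a b,
      IntegrableOn (fun t => ‖A (rayPoint v t)‖ * ‖F (rayPoint v t)‖) (Set.Ioi 0)) :
    algRayIntegral ψ A F b = algRayIntegral ψ A F a := by
  have hA' : ∀ w : ℂ, w.im ∈ Set.Icc a b →
      RightHolAt ψ (fun w => A (Complex.exp w) * ψ (Complex.exp w)) w := fun w hw =>
    RightHolAt.mul_right (RightHolAt.comp
      (by rw [exp_eq_rayPoint]; exact hA _ hw _ (Real.exp_pos _)) (Complex.hasDerivAt_exp w))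
      (Complex.hasDerivAt_exp w)
  have hF' : ∀ w : ℂ, w.im ∈ Set.Icc a b → LeftHolAt ψ (fun w => F (Complex.exp w)) w := fun w hw =>
    LeftHolAt.comp
      (by rw [exp_eq_rayPoint]; exact hF _ hw _ (Real.exp_pos _)) (Complex.hasDerivAt_exp w)
  have hexp : ∀ u v : ℝ, Complex.exp (u + v * Complex.I) = rayPoint v (Real.exp u) := by
    intro u v; rw [exp_eq_rayPoint]; simp
  have hbound : ∀ v : ℝ, ∀ t, 0 < t →
      ‖A (rayPoint v t) * ψ (rayPoint v t)‖ * ‖F (rayPoint v t)‖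
        ≤ ‖algHomCLM ψ‖ * (t * (‖A (rayPoint v t)‖ * ‖F (rayPoint v t)‖)) := by
    intro v t ht
    have h1 := norm_complexAlgHom_le ψ (rayPoint v t)
    rw [norm_rayPoint ht] at h1
    calc _ ≤ (‖A (rayPoint v t)‖ * (‖algHomCLM ψ‖ * t)) * ‖F (rayPoint v t)‖ := by
          gcongr; exact (norm_mul_le _ _).trans (by gcongr)
      _ = _ := by ring
  have h := integral_strip (M := ‖algHomCLM ψ‖ * M) hab hA' hF'
    (fun w hw => by
      rw [exp_eq_rayPoint]
      refine (hbound _ _ (Real.exp_pos _)).trans ?_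
      gcongr
      exact hM _ hw _ (Real.exp_pos _))
    (fun v hv => by
      have h1 := ((integrableOn_Ioi_iff_integrable_exp _).1 (hi v hv)).const_mul ‖algHomCLM ψ‖
      refine h1.mono' (Continuous.aestronglyMeasurable ?_) (Eventually.of_forall fun u => ?_)
      · have him : ∀ u : ℝ, ((u : ℂ) + v * Complex.I).im ∈ Set.Icc a b := by intro u; simpa using hv
        refine Continuous.mul ?_ ?_
        · refine Continuous.norm (continuous_iff_continuousAt.2 fun u => ?_)
          exact ContinuousAt.comp (f := fun u : ℝ => (u : ℂ) + v * Complex.I)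
            (g := fun w => A (Complex.exp w) * ψ (Complex.exp w)) (hA' _ (him u)).continuousAt
            (Continuous.continuousAt (by fun_prop))
        · refine Continuous.norm (continuous_iff_continuousAt.2 fun u => ?_)
          exact ContinuousAt.comp (f := fun u : ℝ => (u : ℂ) + v * Complex.I)
            (g := fun w => F (Complex.exp w)) (hF' _ (him u)).continuousAt
            (Continuous.continuousAt (by fun_prop))
      · rw [hexp, Real.norm_eq_abs, abs_of_nonneg (by positivity)]
        exact hbound _ _ (Real.exp_pos _))
  have key : ∀ v : ℝ, algRayIntegral ψ A F v = ∫ u : ℝ, A (Complex.exp (u + v * Complex.I)) *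
      ψ (Complex.exp (u + v * Complex.I)) * -ψ Complex.I *
      F (Complex.exp (u + v * Complex.I)) := by
    intro v
    rw [algRayIntegral, integral_Ioi_eq_integral_exp]
    refine integral_congr_ae (Eventually.of_forall fun u => ?_)
    simp only [rayIntegrand]
    rw [hexp]
    have : ψ (rayPoint v (Real.exp u)) = Real.exp u • ψ (rayPoint v 1) := by
      rw [rayPoint_eq_smul, map_smul]
    rw [this]
    simp only [mul_assoc, smul_mul_assoc, mul_smul_comm]
  rw [key, key]
  exact h

end Sector

end

/-! ### Unbounded operators through their graphs. -/

noncomputable section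

open MeasureTheory Filter Topology

section Graph

variable {V : Type*} [AddCommGroup V] [Module ℝ V]

theorem mem_graph_opComp (S T : V →ₗ.[ℝ] V) (v w : V) :
    (v, w) ∈ (opComp S T).graph ↔ ∃ u, (v, u) ∈ T.graph ∧ (u, w) ∈ S.graph := by
  constructor
  · intro h
    obtain ⟨⟨x, hx⟩, rfl, rfl⟩ := LinearPMap.mem_graph_iff _ |>.1 h
    exact ⟨_, T.mem_graph ⟨x, hx.fst⟩, S.mem_graph ⟨_, hx.snd⟩⟩
  · rintro ⟨u, h1, h2⟩
    obtain ⟨⟨x, hx⟩, rfl, rfl⟩ := LinearPMap.mem_graph_iff _ |>.1 h1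
    obtain ⟨⟨y, hy⟩, h3, h4⟩ := LinearPMap.mem_graph_iff _ |>.1 h2
    have hxy : T ⟨x, hx⟩ ∈ S.domain := by
      have h5 : y = T ⟨x, hx⟩ := h3
      rwa [← h5]
    refine (LinearPMap.mem_graph_iff _).2 ⟨⟨x, hx, hxy⟩, rfl, ?_⟩
    refine Eq.trans ?_ h4
    exact congrArg S (Subtype.ext h3.symm)

theorem mem_graph_opPow_zero (T : V →ₗ.[ℝ] V) (v w : V) : (v, w) ∈ (opPow T 0).graph ↔ v = w := by
  rw [LinearPMap.mem_graph_iff]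
  constructor
  · rintro ⟨⟨x, hx⟩, rfl, rfl⟩; rfl
  · rintro rfl; exact ⟨⟨v, trivial⟩, rfl, rfl⟩

theorem mem_graph_opPow_succ (T : V →ₗ.[ℝ] V) (k : ℕ) (v w : V) :
    (v, w) ∈ (opPow T (k + 1)).graph ↔ ∃ u, (v, u) ∈ (opPow T k).graph ∧ (u, w) ∈ T.graph :=
  mem_graph_opComp _ _ _ _

theorem mem_graph_opPow_one (T : V →ₗ.[ℝ] V) (v w : V) :
    (v, w) ∈ (opPow T 1).graph ↔ (v, w) ∈ T.graph := by
  rw [mem_graph_opPow_succ]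
  simp only [mem_graph_opPow_zero, exists_eq_left']

theorem mem_graph_opPow_two (T : V →ₗ.[ℝ] V) (v w : V) :
    (v, w) ∈ (opPow T 2).graph ↔ ∃ u, (v, u) ∈ T.graph ∧ (u, w) ∈ T.graph := by
  rw [mem_graph_opPow_succ]
  simp only [mem_graph_opPow_one]

theorem polyOp_apply_of_mem_graph (T : V →ₗ.[ℝ] V) (p : Polynomial ℝ) {v : V} {w : ℕ → V}
    (hw : ∀ k ≤ p.natDegree, (v, w k) ∈ (opPow T k).graph) :
    ∃ h : v ∈ (polyOp T p).domain,
      polyOp T p ⟨v, h⟩ = ∑ k ∈ Finset.range (p.natDegree + 1), p.coeff k • w k := by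
  have h : v ∈ (opPow T p.natDegree).domain := LinearPMap.mem_domain_of_mem_graph (hw _ le_rfl)
  refine ⟨h, ?_⟩
  rw [← Fin.sum_univ_eq_sum_range (fun k => p.coeff k • w k)]
  change (∑ k : Fin (p.natDegree + 1), p.coeff k •
    (opPow T k).toFun ∘ₗ Submodule.inclusion (opPow_domain_anti T (Nat.lt_succ_iff.1 k.2)))
      ⟨v, h⟩ = _
  rw [LinearMap.sum_apply]
  refine Finset.sum_congr rfl fun k _ => ?_
  rw [LinearMap.smul_apply]
  congr 1
  have hk := hw k (Nat.lt_succ_iff.1 k.2)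
  exact LinearPMap.mem_graph_snd_inj _ ((opPow T k).mem_graph _) hk rfl

end Graph

/-! ### Closed operators and holomorphy of the resolvent. -/

section Banach

variable {X : Type*} [NormedAddCommGroup X] [NormedSpace ℝ X] {T : X →ₗ.[ℝ] X}

/-- The operators `q = (T² - 2xT + r)⁻¹` and `τ = Tq`. -/
structure QPair (T : X →ₗ.[ℝ] X) (x r : ℝ) (q τ : X →L[ℝ] X) : Prop where
  mem_fst : ∀ v, (q v, τ v) ∈ T.graph
  mem_snd : ∀ v, (τ v, v + (2 * x) • τ v - r • q v) ∈ T.graph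
  left_inv : ∀ v a b, (v, a) ∈ T.graph → (a, b) ∈ T.graph → q (b - (2 * x) • a + r • v) = v

namespace QPair

variable {x r x' r' : ℝ} {q τ q' τ' : X →L[ℝ] X}

/-- `q` commutes with `T`: if w is in the domain, so is T²qw = w + 2xτw - rqw, hence T² - 2xT + r
can be applied to τw = Tqw. The result is Tw, and `q` inverts it. -/
theorem apply_graph (h : QPair T x r q τ) {w w' : X} (hw : (w, w') ∈ T.graph) : τ w = q w' := by
  have h1 := h.mem_fst w
  have h2 := h.mem_snd w
  have h3 := T.graph.sub_mem (T.graph.add_mem hw (T.graph.smul_mem (2 * x) h2))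
    (T.graph.smul_mem r h1)
  have h4 := h.left_inv _ _ _ h2 h3
  rw [← h4]
  congr 1
  simp only [Prod.snd_add, Prod.smul_snd]
  abel

theorem comm (h : QPair T x r q τ) : τ * q = q * τ := by
  ext v
  exact h.apply_graph (h.mem_fst v)

theorem mul_self (h : QPair T x r q τ) : τ * τ = q + (2 * x) • (q * τ) - r • (q * q) := by
  ext v
  have := h.apply_graph (h.mem_snd v)
  simpa using this

/-- A resolvent identity: with Q = T² - 2xT + r and Q' = T² - 2x'T + r', one has Q'q = 1 - (2(x' -
x)τ + (r - r')q). -/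
theorem mul_one_sub_fst (h : QPair T x r q τ) (h' : QPair T x' r' q' τ') :
    q' * (1 - ((2 * (x' - x)) • τ + (r - r') • q)) = q := by
  ext v
  have := h'.left_inv _ _ _ (h.mem_fst v) (h.mem_snd v)
  rw [mul_apply_eq_comp]
  conv_rhs => rw [← this]
  congr 1
  simp
  module

theorem mul_one_sub_snd (h : QPair T x r q τ) (h' : QPair T x' r' q' τ') :
    τ' * (1 - ((2 * (x' - x)) • τ + (r - r') • q)) = τ := by
  ext v
  refine LinearPMap.mem_graph_snd_inj _ (h'.mem_fst _) (h.mem_fst v) ?_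
  exact DFunLike.congr_fun (h.mul_one_sub_fst h') v

end QPair

/-- The closed graph theorem: the graph of `T ∘ B` is the preimage of the graph of `T` under (v, w)
↦ (Bv, w). -/
theorem exists_clm_of_mem_domain [CompleteSpace X] (hT : T.IsClosed) (B : X →L[ℝ] X)
    (hB : ∀ v, B v ∈ T.domain) : ∃ τ : X →L[ℝ] X, ∀ v, (B v, τ v) ∈ T.graph := by
  set g : X →ₗ[ℝ] X := T.toFun ∘ₗ B.toLinearMap.codRestrict T.domain hB with hg
  have hmem : ∀ v, (B v, g v) ∈ T.graph := fun v => T.mem_graph ⟨B v, hB v⟩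
  have hc : Continuous g := by
    apply LinearMap.continuous_of_isClosed_graph
    have : (g.graph : Set (X × X)) = (fun p : X × X => (B p.1, p.2)) ⁻¹' (T.graph : Set (X × X)) := by
      ext ⟨v, w⟩
      simp only [SetLike.mem_coe, LinearMap.mem_graph_iff, Set.mem_preimage]
      constructor
      · rintro rfl; exact hmem v
      · intro h; exact LinearPMap.mem_graph_snd_inj _ h (hmem v) rfl
    rw [this]
    exact hT.preimage (by fun_prop)
  exact ⟨⟨g, hc⟩, hmem⟩

/-- Hille's theorem. The graph is a closed subspace, so its quotient is a Banach space; the class of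
the integral there is the integral of the classes, which vanish. -/
theorem mem_graph_integral [CompleteSpace X] (hT : T.IsClosed) {α : Type*} [MeasurableSpace α]
    {μ : Measure α} {f g : α → X} (hf : Integrable f μ) (hg : Integrable g μ)
    (h : ∀ᵐ a ∂μ, (f a, g a) ∈ T.graph) : (∫ a, f a ∂μ, ∫ a, g a ∂μ) ∈ T.graph := by
  have : IsClosed (T.graph : Set (X × X)) := hT
  have h1 := ContinuousLinearMap.integral_comp_comm T.graph.mkQL (hf.prodMk hg)
  rw [integral_pair hf hg] at h1
  rw [← Submodule.Quotient.mk_eq_zero, ← Submodule.mkQ_apply]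
  refine Eq.trans h1.symm ?_
  rw [integral_congr_ae (g := fun _ => 0), integral_zero]
  filter_upwards [h] with a ha
  exact (Submodule.Quotient.mk_eq_zero _).2 ha

/-- Near z₀ the relation gives G(z) = G(z₀)(1 - E(z))⁻¹, so no continuity of `G` is needed
beforehand. -/
theorem hasFDerivAt_of_mul_one_sub {𝔅 : Type*} [NormedRing 𝔅] [NormedAlgebra ℝ 𝔅]
    [CompleteSpace 𝔅] {G E : ℂ → 𝔅} {D : ℂ →L[ℝ] 𝔅} {z₀ : ℂ} (hE : HasFDerivAt E D z₀)
    (h0 : E z₀ = 0) (h : ∀ᶠ z in 𝓝 z₀, G z * (1 - E z) = G z₀) :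
    ∃ G' : ℂ →L[ℝ] 𝔅, HasFDerivAt G G' z₀ ∧ ∀ h, G' h = G z₀ * D h := by
  have hsub : HasFDerivAt (fun z => 1 - E z) (-D) z₀ := hE.const_sub 1
  have hinv : HasFDerivAt (fun z => Ring.inverse (1 - E z)) _ z₀ :=
    HasFDerivAt.comp z₀ (g := Ring.inverse) (f := fun z => 1 - E z)
      (by simpa [h0] using hasFDerivAt_ringInverse (𝕜 := ℝ) (1 : 𝔅ˣ)) hsub
  have hev : ∀ᶠ z in 𝓝 z₀, IsUnit (1 - E z) := by
    refine hsub.continuousAt.eventually (Units.isOpen.mem_nhds ?_)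
    simp [h0]
  refine ⟨_, (hinv.const_mul (G z₀)).congr_of_eventuallyEq ?_, fun h => ?_⟩
  · filter_upwards [h, hev] with z hz hu
    rw [← hz, mul_assoc, Ring.mul_inverse_cancel _ hu, mul_one]
  · simp

/-- The resolvent identity differentiates `q` and `τ` to qD and τD, with D the derivative of the
correction `E`. As `q` and `τ` commute and τ² = q + 2xqτ - rq², everything reduces to q, qτ and q².
Neither operator need commute with ψ(i), so only right holomorphy results. -/
theorem rightHolAt_of_qPair [CompleteSpace X] (ψ : ℂ →ₐ[ℝ] (X →L[ℝ] X)) {W : Set ℂ} (hW : IsOpen W)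
    {q τ : ℂ → X →L[ℝ] X} (h : ∀ z ∈ W, QPair T z.re (z.re ^ 2 + z.im ^ 2) (q z) (τ z))
    {z : ℂ} (hz : z ∈ W) :
    RightHolAt ψ (fun z => q z * ψ (starRingEnd ℂ z) - τ z) z := by
  set E : ℂ → X →L[ℝ] X := fun w => (2 * (w.re - z.re)) • τ z
    + (z.re ^ 2 + z.im ^ 2 - (w.re ^ 2 + w.im ^ 2)) • q z with hE
  have hre : HasFDerivAt (fun w : ℂ => w.re) Complex.reCLM z := Complex.reCLM.hasFDerivAt
  have him : HasFDerivAt (fun w : ℂ => w.im) Complex.imCLM z := Complex.imCLM.hasFDerivAt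
  have hE' : HasFDerivAt E _ z := (((hre.sub_const z.re).const_mul 2).smul_const (τ z)).add
    ((((hre.pow 2).add (him.pow 2)).const_sub (z.re ^ 2 + z.im ^ 2)).smul_const (q z))
  have h0 : E z = 0 := by simp [hE]
  obtain ⟨q', hq', hq''⟩ := hasFDerivAt_of_mul_one_sub (G := q) hE' h0
    (by filter_upwards [hW.mem_nhds hz] with w hw using (h z hz).mul_one_sub_fst (h w hw))
  obtain ⟨τ', hτ', hτ''⟩ := hasFDerivAt_of_mul_one_sub (G := τ) hE' h0
    (by filter_upwards [hW.mem_nhds hz] with w hw using (h z hz).mul_one_sub_snd (h w hw))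
  have hψ : HasFDerivAt (fun w => ψ (starRingEnd ℂ w))
      (algHomCLM ψ ∘L Complex.conjCLE.toContinuousLinearMap) z :=
    (algHomCLM ψ).hasFDerivAt.comp z Complex.conjCLE.hasFDerivAt
  have hI : ψ Complex.I * ψ Complex.I = -1 := by rw [← map_mul, Complex.I_mul_I, map_neg, map_one]
  have hc := (h z hz).comm
  have hs := (h z hz).mul_self
  -- The witness is the derivative in the direction 1, simplified by the formula for τ².
  refine ⟨-q z + (2 * z.im ^ 2) • (q z * q z)
    + ((2 * z.re * z.im) • (q z * q z) - (2 * z.im) • (q z * τ z)) * ψ Complex.I, _,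
    (hq'.mul' hψ).sub hτ', fun w => ?_⟩
  simp only [sub_apply, add_apply, smul_apply, smul_eq_mul, MulOpposite.smul_eq_mul_unop,
    MulOpposite.unop_op, hq'', hτ'', ContinuousLinearMap.comp_apply, algHomCLM_apply,
    ContinuousLinearMap.smulRight_apply, ContinuousLinearEquiv.coe_coe, Complex.conjCLE_apply,
    Complex.reCLM_apply, Complex.imCLM_apply, neg_apply]
  rw [complexAlgHom_eq ψ (starRingEnd ℂ z), complexAlgHom_eq ψ (starRingEnd ℂ w),
    complexAlgHom_eq ψ w]
  simp only [Complex.conj_re, Complex.conj_im, mul_add, add_mul, sub_mul, smul_mul_assoc,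
    mul_smul_comm, mul_one, hs, hc, mul_assoc, hI, mul_neg, neg_mul]
  simp
  module

end Banach

end

/-! ### Restriction of the resolvent and of f to a slice. -/

noncomputable section

open MeasureTheory Filter Topology

theorem leftHolAt_of_cauchyRiemann {𝔅 : Type*} [NormedRing 𝔅] [NormedAlgebra ℝ 𝔅]
    (ψ : ℂ →ₐ[ℝ] 𝔅) {u₀ u₁ : ℂ → 𝔅} {z : ℂ} {D₀ D₁ : ℂ →L[ℝ] 𝔅} (h₀ : HasFDerivAt u₀ D₀ z)
    (h₁ : HasFDerivAt u₁ D₁ z) (c₁ : D₀ 1 = D₁ Complex.I) (c₂ : D₀ Complex.I = -D₁ 1) :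
    LeftHolAt ψ (fun w => u₀ w + ψ Complex.I * u₁ w) z := by
  have hI : ψ Complex.I * ψ Complex.I = -1 := by rw [← map_mul, Complex.I_mul_I, map_neg, map_one]
  have hsplit : ∀ (g : ℂ →L[ℝ] 𝔅) (w : ℂ), g w = w.re • g 1 + w.im • g Complex.I := by
    intro g w
    rw [← map_smul, ← map_smul, ← map_add]
    simp
  refine ⟨D₀ 1 + ψ Complex.I * D₁ 1, _, h₀.add (h₁.const_mul (ψ Complex.I)), fun h => ?_⟩
  rw [complexAlgHom_eq ψ h]
  simp only [add_apply, smul_apply, smul_eq_mul]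
  rw [hsplit D₀ h, hsplit D₁ h, c₂, ← c₁]
  simp only [mul_add, add_mul, smul_mul_assoc, one_mul, ← mul_assoc, hI, mul_smul_comm, smul_neg,
    neg_mul]
  abel

namespace CliffModule

open Paravector

variable {d : ℕ} {E : Type*} [NormedAddCommGroup E] [NormedSpace ℝ E]

/-- The algebra homomorphism `x + iy ↦ (v ↦ (x + Jy)v)` from `ℂ` to `ℬ(V)`. -/
def sliceHom (E : Type*) [NormedAddCommGroup E] [NormedSpace ℝ E] {J : Paravector d}
    (hJ : J ∈ unitSphere d) : ℂ →ₐ[ℝ] (CliffModule d E →L[ℝ] CliffModule d E) :=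
  (leftMulHom d E).comp (Complex.liftAux J.toCliff (toCliff_mul_self hJ))

theorem sliceHom_apply {J : Paravector d} (hJ : J ∈ unitSphere d) (z : ℂ) :
    sliceHom E hJ z = leftMul (ofComplex J z).toCliff := by
  rw [sliceHom, AlgHom.comp_apply, Complex.liftAux_apply, leftMulHom_apply, ofComplex,
    toCliff_slicePoint]

theorem leftMul_mul (s t : Cliff d) : leftMul (E := E) (s * t) = leftMul s * leftMul t :=
  map_mul (leftMulHom d E) s t

theorem leftMul_add (s t : Cliff d) : leftMul (E := E) (s + t) = leftMul s + leftMul t :=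
  map_add (leftMulHom d E) s t

theorem leftMul_neg (s : Cliff d) : leftMul (E := E) (-s) = -leftMul s :=
  map_neg (leftMulHom d E) s

theorem sliceHom_I {J : Paravector d} (hJ : J ∈ unitSphere d) :
    sliceHom E hJ Complex.I = leftMul J.toCliff := by
  rw [sliceHom_apply, ofComplex, toCliff_slicePoint]
  simp

theorem sliceHom_eq {J : Paravector d} (hJ : J ∈ unitSphere d) (z : ℂ) :
    sliceHom E hJ z = z.re • (1 : CliffModule d E →L[ℝ] CliffModule d E)
      + z.im • leftMul J.toCliff := by
  rw [sliceHom, AlgHom.comp_apply, Complex.liftAux_apply, map_add, map_smul, AlgHom.commutes,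
    leftMulHom_apply, Algebra.algebraMap_eq_smul_one]

theorem leftMul_conj {J : Paravector d} (hJ : J ∈ unitSphere d) (z : ℂ) :
    leftMul (E := E) (conj (ofComplex J z)).toCliff = sliceHom E hJ (starRingEnd ℂ z) := by
  rw [sliceHom_apply, ofComplex, ofComplex, conj_slicePoint hJ, Complex.conj_re, Complex.conj_im]

variable {T : CliffModule d E →ₗ.[ℝ] CliffModule d E}

theorem mem_graph_Qop {s : Paravector d} {v a b : CliffModule d E} (h1 : (v, a) ∈ T.graph)
    (h2 : (a, b) ∈ T.graph) : ∃ h : v ∈ (Qop T s).domain,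
      Qop T s ⟨v, h⟩ = b - (2 * s 0) • a + ‖s‖ ^ 2 • v := by
  have h3 := (mem_graph_opPow_two T v b).2 ⟨a, h1, h2⟩
  have h4 := (mem_graph_opPow_one T v a).2 h1
  have hv : v ∈ (opPow T 2).domain := LinearPMap.mem_domain_of_mem_graph h3
  refine ⟨hv, ?_⟩
  have e1 : (opPow T 2) ⟨v, hv⟩ = b :=
    LinearPMap.mem_graph_snd_inj _ ((opPow T 2).mem_graph ⟨v, hv⟩) h3 rfl
  have e2 : (opPow T 1) ⟨v, opPow_domain_anti T one_le_two hv⟩ = a :=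
    LinearPMap.mem_graph_snd_inj _ ((opPow T 1).mem_graph ⟨v, _⟩) h4 rfl
  rw [← e1, ← e2]
  rfl

/-- The range of the inverse lies in dom(T²), hence in dom(T), so τ = TB is bounded by the closed
graph theorem. -/
theorem IsQInverse.exists_qPair [CompleteSpace E] (hT : T.IsClosed) {s : Paravector d}
    {B : CliffModule d E →L[ℝ] CliffModule d E} (h : IsQInverse T s B) :
    ∃ τ, QPair T (s 0) (‖s‖ ^ 2) B τ := by
  obtain ⟨τ, hτ⟩ := exists_clm_of_mem_domain hT B fun v =>
    LinearPMap.mem_domain_of_mem_graph ((mem_graph_opPow_one T _ _).1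
      ((opPow T 1).mem_graph ⟨B v, opPow_domain_anti T one_le_two (h.right_inv v).fst⟩))
  refine ⟨τ, hτ, fun v => ?_, fun v a b h1 h2 => ?_⟩
  · obtain ⟨h3, h4⟩ := h.right_inv v
    obtain ⟨c, hc⟩ : ∃ c, (B v, c) ∈ (opPow T 2).graph := ⟨_, (opPow T 2).mem_graph ⟨B v, h3⟩⟩
    obtain ⟨a, h5, h6⟩ := (mem_graph_opPow_two T _ _).1 hc
    have h7 : a = τ v := LinearPMap.mem_graph_snd_inj _ h5 (hτ v) rfl
    obtain ⟨h8, h9⟩ := mem_graph_Qop (s := s) h5 h6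
    rw [h7] at h6 h9
    have h10 := h9.symm.trans h4
    convert h6 using 2
    have h11 : ∀ x y : CliffModule d E, c - x + y = v → v + x - y = c := by
      rintro x y rfl; abel
    exact h11 _ _ h10
  · obtain ⟨h3, h4⟩ := mem_graph_Qop (s := s) h1 h2
    rw [← h4]
    exact h.left_inv ⟨v, h3⟩

theorem isQInverse_Qinv {s : Paravector d} (hs : s ∈ resolventSetS T) :
    IsQInverse T s (Qinv T s) := by
  have h : ∃ B, IsQInverse T s B := hs
  rw [Qinv, dif_pos h]
  exact h.choose_spec

theorem leftResolvent_eq {s : Paravector d} {τ : CliffModule d E →L[ℝ] CliffModule d E}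
    (hτ : ∀ v, (Qinv T s v, τ v) ∈ T.graph) :
    leftResolvent T s = Qinv T s * leftMul (conj s).toCliff - τ := by
  have h1 : IsLeftResolvent T s (Qinv T s * leftMul (conj s).toCliff - τ) := by
    intro v
    refine ⟨LinearPMap.mem_domain_of_mem_graph (hτ v), ?_⟩
    rw [LinearPMap.mem_graph_snd_inj _ (T.mem_graph ⟨_, LinearPMap.mem_domain_of_mem_graph (hτ v)⟩)
      (hτ v) rfl]
    rfl
  have h : ∃ A, IsLeftResolvent T s A := ⟨_, h1⟩
  rw [leftResolvent, dif_pos h]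
  -- The defining relation prescribes all values, so the chosen operator is the only one.
  ext1 v
  obtain ⟨_, h2⟩ := h.choose_spec v
  obtain ⟨_, h3⟩ := h1 v
  rw [h2, h3]

/-- The resolvent `S_L⁻¹(x + Jy, T)` as a function of `x + iy`. -/
def sliceResolvent (T : CliffModule d E →ₗ.[ℝ] CliffModule d E) (J : Paravector d) (z : ℂ) :
    CliffModule d E →L[ℝ] CliffModule d E := leftResolvent T (ofComplex J z)

/-- Q_s[T] depends only on s₀ and |s|, so one pair `q`, `τ` serves every slice; `J` enters the
resolvent only through the conjugate of s. -/
theorem IsBisectorial.exists_qPair [CompleteSpace E] {ω : ℝ} (hω : ω ∈ Set.Ioo 0 (Real.pi / 2))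
    (hT : IsBisectorial T ω) {J₀ : Paravector d} (hJ₀ : J₀ ∈ unitSphere d) :
    ∃ q τ : ℂ → CliffModule d E →L[ℝ] CliffModule d E, ∀ z ∈ planeExterior ω,
      QPair T z.re (z.re ^ 2 + z.im ^ 2) (q z) (τ z) ∧
      ∀ (J : Paravector d) (hJ : J ∈ unitSphere d),
        sliceResolvent T J z = q z * sliceHom E hJ (starRingEnd ℂ z) - τ z := by
  have key : ∀ z ∈ planeExterior ω, ∀ J ∈ unitSphere d,
      ∃ τ, QPair T z.re (z.re ^ 2 + z.im ^ 2) (Qinv T (ofComplex J z)) τ := by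
    intro z hz J hJ
    have h1 : ofComplex J z ∈ resolventSetS T := by
      by_contra h
      exact ofComplex_notMem_closure hJ hω hz (hT.spectrum_subset h)
    obtain ⟨τ, hτ⟩ := (isQInverse_Qinv h1).exists_qPair hT.isClosedOperator.closed
    refine ⟨τ, ?_⟩
    rwa [ofComplex_zero_apply hJ, ofComplex, norm_sq_slicePoint hJ] at hτ
  choose! τ hτ using key
  refine ⟨fun z => Qinv T (ofComplex J₀ z), fun z => τ z J₀, fun z hz => ⟨hτ z hz J₀ hJ₀, ?_⟩⟩
  intro J hJ
  -- For equal parameters the resolvent identity says that the inverses chosen at the two points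
  -- coincide.
  have h1 := (hτ z hz J₀ hJ₀).mul_one_sub_fst (hτ z hz J hJ)
  have h2 := (hτ z hz J₀ hJ₀).mul_one_sub_snd (hτ z hz J hJ)
  simp only [sub_self, mul_zero, zero_smul, add_zero, sub_zero, mul_one] at h1 h2
  rw [sliceResolvent, leftResolvent_eq (hτ z hz J hJ).mem_fst, leftMul_conj hJ, h1, h2]

/-- The function `x + iy ↦ f(x + Jy)`, with values in `ℬ(V)` by left multiplication. -/
def sliceFun (E : Type*) [NormedAddCommGroup E] [NormedSpace ℝ E] (f : Paravector d → Cliff d)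
    (J : Paravector d) (z : ℂ) : CliffModule d E →L[ℝ] CliffModule d E :=
  leftMul (f (ofComplex J z))

theorem leftHolAt_sliceFun {f : Paravector d → Cliff d} {θ : ℝ} (hθ : θ ∈ Set.Ioo 0 (Real.pi / 2))
    (hf : IsLeftSliceHyperholomorphic (doubleSector d θ) f) {J : Paravector d}
    (hJ : J ∈ unitSphere d) {z : ℂ} (hz : z ∈ planeSector θ) :
    LeftHolAt (sliceHom E hJ) (sliceFun E f J) z := by
  obtain ⟨f₀, f₁, h₀, h₁, hf⟩ := hf
  set e : ℂ →L[ℝ] ℝ × ℝ := Complex.equivRealProdCLM.toContinuousLinearMap with he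
  have hmem : ∀ w ∈ planeSector θ, ∀ J ∈ unitSphere d, slicePoint J w.re w.im ∈ doubleSector d θ :=
    fun w hw J hJ => (ofComplex_mem_doubleSector_iff hJ hθ w).2 hw
  have hnhds : {z : ℝ × ℝ | ∀ J ∈ unitSphere d, slicePoint J z.1 z.2 ∈ doubleSector d θ}
      ∈ 𝓝 (z.re, z.im) := by
    have h1 : ContinuousAt (fun p : ℝ × ℝ => Complex.equivRealProdCLM.symm p) (z.re, z.im) :=
      (Complex.equivRealProdCLM.symm.continuous).continuousAt
    have h2 := h1.preimage_mem_nhds ((isOpen_planeSector θ).mem_nhds hz)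
    filter_upwards [h2] with p hp
    exact hmem _ hp
  have d₀ := ((h₀.contDiffAt hnhds).differentiableAt one_ne_zero).hasFDerivAt
  have d₁ := ((h₁.contDiffAt hnhds).differentiableAt one_ne_zero).hasFDerivAt
  obtain ⟨-, -, -, c1, c2⟩ := hf z.re z.im (hmem z hz)
  have D₀ : HasFDerivAt (fun w : ℂ => leftMul (E := E) (f₀ (w.re, w.im))) _ z :=
    (leftMulCLM d E).hasFDerivAt.comp z (HasFDerivAt.comp z (g := f₀) (f := e) d₀ e.hasFDerivAt)
  have D₁ : HasFDerivAt (fun w : ℂ => leftMul (E := E) (f₁ (w.re, w.im))) _ z :=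
    (leftMulCLM d E).hasFDerivAt.comp z (HasFDerivAt.comp z (g := f₁) (f := e) d₁ e.hasFDerivAt)
  have e1 : e 1 = (1, 0) := rfl
  have eI : e Complex.I = (0, 1) := rfl
  have key := leftHolAt_of_cauchyRiemann (sliceHom E hJ) D₀ D₁
    (by simp only [ContinuousLinearMap.comp_apply, e1, eI, c1])
    (by simp only [ContinuousLinearMap.comp_apply, e1, eI, c2, map_neg])
  have hev : sliceFun E f J =ᶠ[𝓝 z] fun w => leftMul (f₀ (w.re, w.im))
      + sliceHom E hJ Complex.I * leftMul (f₁ (w.re, w.im)) := by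
    filter_upwards [(isOpen_planeSector θ).mem_nhds hz] with w hw
    rw [sliceFun, ofComplex, (hf w.re w.im (hmem w hw)).1 J hJ, leftMul_add, leftMul_mul,
      sliceHom_I]
  obtain ⟨b, F', hF, hb⟩ := key
  exact ⟨b, F', hF.congr_of_eventuallyEq hev, hb⟩

theorem rayIntegral_eq (f : Paravector d → Cliff d) {J : Paravector d} (hJ : J ∈ unitSphere d)
    (α : ℝ) : rayIntegral T f J α
      = algRayIntegral (sliceHom E hJ) (sliceResolvent T J) (sliceFun E f J) α := by
  rw [rayIntegral, algRayIntegral]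
  refine integral_congr_ae (Eventually.of_forall fun t => ?_)
  simp only [rayIntegrand]
  rw [sliceHom_I, sliceHom_apply, sliceResolvent, sliceFun, leftMul_mul, leftMul_mul, leftMul_neg,
    polar_eq_ofComplex, polar_eq_ofComplex]
  rfl

/-- Changing the signs of both `J` and α keeps the ray and reverses the sign of ds/J. -/
theorem rayIntegral_neg (T : CliffModule d E →ₗ.[ℝ] CliffModule d E) (f : Paravector d → Cliff d)
    (J : Paravector d) (α : ℝ) : rayIntegral T f J (-α) = -rayIntegral T f (-J) α := by
  rw [rayIntegral, rayIntegral, ← integral_neg]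
  refine integral_congr_ae (Eventually.of_forall fun t => ?_)
  have h : ∀ t, polar J t (-α) = polar (-J) t α := fun t => by
    rw [← polar_neg_neg (-J), neg_neg]
  simp only [h, toCliff_neg, neg_neg, mul_neg, neg_mul, leftMul_neg]
  ext v
  simp

/-- Only the rays of angles φ and π - φ remain, each taken for `J` and `-J`. This symmetric form is
the one in which independence of `J` is visible. -/
theorem omegaCalculus_eq (f : Paravector d → Cliff d) (φ : ℝ) (J : Paravector d) :
    omegaCalculus T f φ J = (1 / (2 * Real.pi)) •
      ((rayIntegral T f J (Real.pi - φ) + rayIntegral T f (-J) (Real.pi - φ))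
        - (rayIntegral T f J φ + rayIntegral T f (-J) φ)) := by
  have h1 : rayIntegral T f J (Real.pi + φ) = -rayIntegral T f (-J) (Real.pi - φ) := by
    rw [← rayIntegral_neg, rayIntegral, rayIntegral]
    have h : ∀ t, polar J t (Real.pi + φ) = polar J t (-(Real.pi - φ)) := fun t => by
      have : Real.pi + φ = -(Real.pi - φ) + 2 * Real.pi := by ring
      rw [polar, polar, this, Real.cos_add_two_pi, Real.sin_add_two_pi]
    simp only [h]
  rw [omegaCalculus, rayIntegral_neg, h1]
  congr 1
  abel

end CliffModule

end

/-! ### Function classes on the complex double sector. -/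

noncomputable section

open MeasureTheory Filter Topology Paravector

section Plane

variable {𝔅 : Type*} [NormedRing 𝔅] [NormedAlgebra ℝ 𝔅] {ψ : ℂ →ₐ[ℝ] 𝔅} {A F G : ℂ → 𝔅} {ω θ : ℝ}

/-- The analogue of `SH_L^0` for left holomorphic functions on a complex double sector. -/
structure PlaneSHL0 (ψ : ℂ →ₐ[ℝ] 𝔅) (θ : ℝ) (F : ℂ → 𝔅) : Prop where
  hol : ∀ z ∈ planeSector θ, LeftHolAt ψ F z
  bounded : ∃ C : ℝ, ∀ z ∈ planeSector θ, ‖F z‖ ≤ C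
  integrable : ∀ φ ∈ angles θ, IntegrableOn (fun t : ℝ => ‖F (rayPoint φ t)‖ / t) (Set.Ioi 0)

/-- Right holomorphic functions on the exterior of a complex double sector with the decay of the
resolvent of a bisectorial operator. -/
structure IsPlaneResolvent (ψ : ℂ →ₐ[ℝ] 𝔅) (ω : ℝ) (A : ℂ → 𝔅) : Prop where
  hol : ∀ z ∈ planeExterior ω, RightHolAt ψ A z
  bound : ∀ φ ∈ Set.Ioo ω (Real.pi / 2), ∃ C : ℝ, 0 ≤ C ∧
    ∀ v t : ℝ, 0 < t → |Real.cos v| ≤ Real.cos φ → ‖A (rayPoint v t)‖ ≤ C / t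

theorem rayPoint_mem_planeExterior {φ v t : ℝ} (hω : ω ∈ Set.Ioo 0 (Real.pi / 2))
    (hφ : φ ∈ Set.Ioo ω (Real.pi / 2)) (hv : |Real.cos v| ≤ Real.cos φ) (ht : 0 < t) :
    rayPoint v t ∈ planeExterior ω := by
  have h1 : Real.cos φ < Real.cos ω :=
    Real.cos_lt_cos_of_nonneg_of_le_pi_div_two hω.1.le hφ.2.le hφ.1
  have h2 : (rayPoint v t).re = t * Real.cos v := re_ray t v
  rw [planeExterior, Set.mem_ofPred_eq, h2, norm_rayPoint ht, abs_mul, abs_of_pos ht,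
    mul_comm (Real.cos ω)]
  exact mul_lt_mul_of_pos_left (hv.trans_lt h1) ht

theorem PlaneSHL0.continuousAt (hF : PlaneSHL0 ψ θ F) (hθ : θ ∈ Set.Ioo 0 (Real.pi / 2)) {α t : ℝ}
    (hα : α ∈ angles θ) (ht : 0 < t) : ContinuousAt F (rayPoint α t) :=
  (hF.hol _ (ray_mem_planeSector hθ ht hα)).continuousAt

theorem aestronglyMeasurable_norm_mul_norm {𝔅 : Type*} [NormedRing 𝔅] {A F : ℂ → 𝔅} {α : ℝ}
    (hA : ∀ t, 0 < t → ContinuousAt A (rayPoint α t))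
    (hF : ∀ t, 0 < t → ContinuousAt F (rayPoint α t)) :
    AEStronglyMeasurable (fun t => ‖A (rayPoint α t)‖ * ‖F (rayPoint α t)‖)
      (volume.restrict (Set.Ioi 0)) := by
  refine ContinuousOn.aestronglyMeasurable (fun t ht => ContinuousAt.continuousWithinAt ?_)
    measurableSet_Ioi
  have h1 := ContinuousAt.comp (f := rayPoint α) (hA t ht) (continuous_rayPoint α).continuousAt
  have h2 := ContinuousAt.comp (f := rayPoint α) (hF t ht) (continuous_rayPoint α).continuousAt
  exact h1.norm.mul h2.norm

theorem integrableOn_resolvent_mul (hω : ω ∈ Set.Ioo 0 (Real.pi / 2))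
    (hθ : θ ∈ Set.Ioo 0 (Real.pi / 2)) (hA : IsPlaneResolvent ψ ω A) (hF : PlaneSHL0 ψ θ F)
    {φ α : ℝ} (hφ : φ ∈ Set.Ioo ω (Real.pi / 2)) (hα : α ∈ angles θ)
    (hαφ : |Real.cos α| ≤ Real.cos φ) :
    IntegrableOn (fun t => ‖A (rayPoint α t)‖ * ‖F (rayPoint α t)‖) (Set.Ioi 0) := by
  obtain ⟨C, hC, h⟩ := hA.bound φ hφ
  refine ((hF.integrable α hα).const_mul C).mono' (aestronglyMeasurable_norm_mul_norm
    (fun _ ht => (hA.hol _ (rayPoint_mem_planeExterior hω hφ hαφ ht)).continuousAt)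
    (fun _ ht => hF.continuousAt hθ hα ht)) ?_
  filter_upwards [ae_restrict_mem measurableSet_Ioi] with t ht
  rw [Real.norm_eq_abs, abs_of_nonneg (by positivity)]
  refine (mul_le_mul_of_nonneg_right (h α t ht hαφ) (norm_nonneg _)).trans (le_of_eq ?_)
  ring

theorem integrableOn_rayIntegrand_resolvent (hω : ω ∈ Set.Ioo 0 (Real.pi / 2))
    (hθ : θ ∈ Set.Ioo 0 (Real.pi / 2)) (hA : IsPlaneResolvent ψ ω A) (hF : PlaneSHL0 ψ θ F)
    {φ α : ℝ} (hφ : φ ∈ Set.Ioo ω (Real.pi / 2)) (hα : α ∈ angles θ)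
    (hαφ : |Real.cos α| ≤ Real.cos φ) :
    IntegrableOn (rayIntegrand ψ A F α) (Set.Ioi 0) :=
  integrableOn_rayIntegrand
    (fun _ ht => (hA.hol _ (rayPoint_mem_planeExterior hω hφ hαφ ht)).continuousAt)
    (fun _ ht => hF.continuousAt hθ hα ht) (integrableOn_resolvent_mul hω hθ hA hF hφ hα hαφ)

/-- The bound C/t on the resolvent and boundedness of `F` control t‖A‖‖F‖, as the rotation of rays
requires. -/
theorem algRayIntegral_resolvent_eq [CompleteSpace 𝔅] (hω : ω ∈ Set.Ioo 0 (Real.pi / 2))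
    (hθ : θ ∈ Set.Ioo 0 (Real.pi / 2)) (hA : IsPlaneResolvent ψ ω A) (hF : PlaneSHL0 ψ θ F)
    {φ a b : ℝ} (hφ : φ ∈ Set.Ioo ω (Real.pi / 2)) (hab : a ≤ b)
    (hv : ∀ v ∈ Set.Icc a b, v ∈ angles θ ∧ |Real.cos v| ≤ Real.cos φ) :
    algRayIntegral ψ A F b = algRayIntegral ψ A F a := by
  obtain ⟨C, hC, h⟩ := hA.bound φ hφ
  obtain ⟨K, hK⟩ := hF.bounded
  refine algRayIntegral_eq (M := C * K) hab
    (fun v hvm _ ht => hA.hol _ (rayPoint_mem_planeExterior hω hφ (hv v hvm).2 ht))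
    (fun v hvm _ ht => hF.hol _ (ray_mem_planeSector hθ ht (hv v hvm).1)) (fun v hvm t ht => ?_)
    (fun v hvm => integrableOn_resolvent_mul hω hθ hA hF hφ (hv v hvm).1 (hv v hvm).2)
  have h1 := h v t ht (hv v hvm).2
  have h2 := hK _ (ray_mem_planeSector hθ ht (hv v hvm).1)
  rw [le_div_iff₀ ht] at h1
  calc t * (‖A (rayPoint v t)‖ * ‖F (rayPoint v t)‖)
      = (‖A (rayPoint v t)‖ * t) * ‖F (rayPoint v t)‖ := by ring
    _ ≤ C * K := mul_le_mul h1 h2 (norm_nonneg _) hC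

/-- ψ(z) has inverse ψ(z⁻¹). As ψ is not assumed isometric, the norm of ψ enters. -/
theorem norm_mul_norm_le (ψ : ℂ →ₐ[ℝ] 𝔅) (z : ℂ) (x : 𝔅) :
    ‖z‖ * ‖x‖ ≤ ‖algHomCLM ψ‖ * ‖ψ z * x‖ := by
  by_cases hz : z = 0
  · simp [hz]
  · have h1 : x = ψ z⁻¹ * (ψ z * x) := by
      rw [← mul_assoc, ← map_mul, inv_mul_cancel₀ hz, map_one, one_mul]
    have hn : 0 < ‖z‖ := norm_pos_iff.2 hz
    have h2 : ‖x‖ ≤ ‖algHomCLM ψ‖ * ‖z‖⁻¹ * ‖ψ z * x‖ := by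
      conv_lhs => rw [h1]
      refine (norm_mul_le _ _).trans (mul_le_mul_of_nonneg_right ?_ (norm_nonneg _))
      rw [← norm_inv]; exact norm_complexAlgHom_le ψ _
    calc ‖z‖ * ‖x‖ ≤ ‖z‖ * (‖algHomCLM ψ‖ * ‖z‖⁻¹ * ‖ψ z * x‖) := by gcongr
      _ = _ := by field_simp

/-- Since |F| is at most a constant times |zF|/t, integrability against dt is that of zF against
dt/t. -/
theorem integrableOn_one_mul (hθ : θ ∈ Set.Ioo 0 (Real.pi / 2)) (hF : PlaneSHL0 ψ θ F)
    (hzF : PlaneSHL0 ψ θ fun z => ψ z * F z) {α : ℝ} (hα : α ∈ angles θ) :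
    IntegrableOn (fun t => ‖(fun _ => 1 : ℂ → 𝔅) (rayPoint α t)‖ * ‖F (rayPoint α t)‖)
      (Set.Ioi 0) := by
  refine ((hzF.integrable α hα).const_mul (‖(1 : 𝔅)‖ * ‖algHomCLM ψ‖)).mono'
    (aestronglyMeasurable_norm_mul_norm
    (fun t ht => continuousAt_const) (fun _ ht => hF.continuousAt hθ hα ht)) ?_
  filter_upwards [ae_restrict_mem measurableSet_Ioi] with t ht
  have ht : 0 < t := ht
  rw [Real.norm_eq_abs, abs_of_nonneg (by positivity)]
  have := norm_mul_norm_le ψ (rayPoint α t) (F (rayPoint α t))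
  rw [norm_rayPoint ht] at this
  rw [mul_assoc]
  refine mul_le_mul_of_nonneg_left ?_ (norm_nonneg _)
  rw [← mul_div_assoc, le_div_iff₀ ht]
  linarith

/-- Without the resolvent the rays may cross the spectrum, so a whole component of the double sector
can be swept. Boundedness of zF replaces the resolvent bound. -/
theorem algRayIntegral_one_eq [CompleteSpace 𝔅] (hθ : θ ∈ Set.Ioo 0 (Real.pi / 2))
    (hF : PlaneSHL0 ψ θ F) (hzF : PlaneSHL0 ψ θ fun z => ψ z * F z) {a b : ℝ} (hab : a ≤ b)
    (hv : ∀ v ∈ Set.Icc a b, v ∈ angles θ) :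
    algRayIntegral ψ (fun _ => 1) F b = algRayIntegral ψ (fun _ => 1) F a := by
  obtain ⟨K, hK⟩ := hzF.bounded
  refine algRayIntegral_eq (M := ‖(1 : 𝔅)‖ * (‖algHomCLM ψ‖ * K)) hab
    (fun v hvm t ht => rightHolAt_const 1)
    (fun v hvm t ht => hF.hol _ (ray_mem_planeSector hθ ht (hv v hvm))) (fun v hvm t ht => ?_)
    (fun v hvm => integrableOn_one_mul hθ hF hzF (hv v hvm))
  have := norm_mul_norm_le ψ (rayPoint v t) (F (rayPoint v t))
  rw [norm_rayPoint ht] at this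
  have h2 := hK _ (ray_mem_planeSector hθ ht (hv v hvm))
  calc t * (‖(1 : 𝔅)‖ * ‖F (rayPoint v t)‖) = ‖(1 : 𝔅)‖ * (t * ‖F (rayPoint v t)‖) := by ring
    _ ≤ _ := mul_le_mul_of_nonneg_left (this.trans (by gcongr; exact h2)) (norm_nonneg _)

theorem PlaneSHL0.of_norm_le (hθ : θ ∈ Set.Ioo 0 (Real.pi / 2)) (hF : PlaneSHL0 ψ θ F)
    (hG : PlaneSHL0 ψ θ G) {H : ℂ → 𝔅} (hH : ∀ z ∈ planeSector θ, LeftHolAt ψ H z) {C : ℝ}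
    (hC : 0 ≤ C) (h : ∀ z, ‖H z‖ ≤ C * (‖F z‖ + ‖G z‖)) : PlaneSHL0 ψ θ H := by
  obtain ⟨K, hK⟩ := hF.bounded
  obtain ⟨L, hL⟩ := hG.bounded
  refine ⟨hH, ⟨C * (K + L), fun z hz => (h z).trans ?_⟩, fun φ hφ => ?_⟩
  · exact mul_le_mul_of_nonneg_left (add_le_add (hK z hz) (hL z hz)) hC
  · refine (((hF.integrable φ hφ).add (hG.integrable φ hφ)).const_mul C).mono' ?_ ?_
    · refine ContinuousOn.aestronglyMeasurable (fun t ht => ContinuousAt.continuousWithinAt ?_)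
        measurableSet_Ioi
      have h2 := ContinuousAt.comp (f := rayPoint φ)
        (hH _ (ray_mem_planeSector hθ ht hφ)).continuousAt (continuous_rayPoint φ).continuousAt
      exact h2.norm.div continuousAt_id (ne_of_gt ht)
    · filter_upwards [ae_restrict_mem measurableSet_Ioi] with t ht
      have ht : 0 < t := ht
      rw [Real.norm_eq_abs, abs_of_nonneg (by positivity), Pi.add_apply, ← add_div, ← mul_div_assoc]
      exact div_le_div_of_nonneg_right (h _) ht.le

theorem exists_norm_pow_le (p : Polynomial ℝ) (hp : p ≠ 0) :
    ∃ C : ℝ, 0 ≤ C ∧ ∀ k ≤ p.natDegree, ∀ z : ℂ,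
      ‖z‖ ^ k ≤ C * (1 + ‖Polynomial.aeval z p‖) := by
  set n := p.natDegree with hn
  have ha : 0 < |p.coeff n| := abs_pos.2 (by rw [hn]; exact Polynomial.leadingCoeff_ne_zero.2 hp)
  set S := ∑ k ∈ Finset.range n, |p.coeff k| with hS
  have hS0 : 0 ≤ S := Finset.sum_nonneg fun _ _ => abs_nonneg _
  -- Beyond this radius the lower terms amount to at most half of the leading one.
  set R := max 1 (2 * S / |p.coeff n|) with hR
  have hR1 : 1 ≤ R := le_max_left _ _
  -- R^n bounds |z|^k for |z| ≤ R, and 2/|p_n| is the factor against |p(z)| outside.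
  refine ⟨R ^ n + 2 / |p.coeff n|, by positivity, fun k hk z => ?_⟩
  rcases le_total ‖z‖ R with hz | hz
  · have h1 : ‖z‖ ^ k ≤ R ^ n :=
      (pow_le_pow_left₀ (norm_nonneg _) hz k).trans (pow_le_pow_right₀ hR1 hk)
    have h2 : 0 ≤ 2 / |p.coeff n| := by positivity
    have h3 := norm_nonneg (Polynomial.aeval z p)
    have h4 : 0 ≤ R ^ n := by positivity
    nlinarith [mul_nonneg h4 h3, mul_nonneg h2 h3]
  · have hz1 : 1 ≤ ‖z‖ := hR1.trans hz
    have hzS : 2 * S ≤ ‖z‖ * |p.coeff n| := by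
      rw [← div_le_iff₀ ha]; exact (le_max_right _ _).trans hz
    have h1 : Polynomial.aeval z p = ∑ k ∈ Finset.range n, (p.coeff k : ℂ) * z ^ k
        + (p.coeff n : ℂ) * z ^ n := by
      rw [Polynomial.aeval_eq_sum_range, Finset.sum_range_succ]
      simp [hn]
    set W := ∑ k ∈ Finset.range n, (p.coeff k : ℂ) * z ^ k with hW
    have h2 : ‖W‖ * ‖z‖ ≤ S * ‖z‖ ^ n := by
      refine (mul_le_mul_of_nonneg_right (norm_sum_le _ _) (norm_nonneg _)).trans ?_
      rw [Finset.sum_mul, hS, Finset.sum_mul]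
      refine Finset.sum_le_sum fun k hk => ?_
      rw [norm_mul, norm_pow, Complex.norm_real, Real.norm_eq_abs, mul_assoc, ← pow_succ]
      exact mul_le_mul_of_nonneg_left
        (pow_le_pow_right₀ hz1 (Nat.succ_le_of_lt (Finset.mem_range.1 hk))) (abs_nonneg _)
    have h3 : 2 * ‖W‖ ≤ |p.coeff n| * ‖z‖ ^ n := by
      have hp1 : 0 ≤ ‖z‖ ^ n := by positivity
      refine le_of_mul_le_mul_right ?_ (zero_lt_one.trans_le hz1)
      nlinarith [mul_le_mul_of_nonneg_right hzS hp1]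
    have h4 : |p.coeff n| * ‖z‖ ^ n ≤ ‖Polynomial.aeval z p‖ + ‖W‖ := by
      have : (p.coeff n : ℂ) * z ^ n = Polynomial.aeval z p - W := by rw [h1]; ring
      calc |p.coeff n| * ‖z‖ ^ n = ‖(p.coeff n : ℂ) * z ^ n‖ := by
            rw [norm_mul, norm_pow, Complex.norm_real, Real.norm_eq_abs]
        _ ≤ _ := by rw [this]; exact norm_sub_le _ _
    have h5 : ‖z‖ ^ n ≤ 2 / |p.coeff n| * ‖Polynomial.aeval z p‖ := by
      rw [div_mul_eq_mul_div, le_div_iff₀ ha]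
      linarith
    have h6 : ‖z‖ ^ k ≤ ‖z‖ ^ n := pow_le_pow_right₀ hz1 hk
    have h7 : 0 ≤ 2 / |p.coeff n| := by positivity
    have h8 : 0 ≤ R ^ n := by positivity
    nlinarith [mul_nonneg h8 (norm_nonneg (Polynomial.aeval z p))]

/-- Where |p(z)| ≤ 1, z^k is at most 2C and `F` dominates; elsewhere z^k/p(z) is at most 2C in
modulus and pF dominates. Zeros of p thus cause no trouble. -/
theorem PlaneSHL0.pow_mul (hθ : θ ∈ Set.Ioo 0 (Real.pi / 2)) (hF : PlaneSHL0 ψ θ F)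
    {p : Polynomial ℝ} (hp : p ≠ 0) (hpF : PlaneSHL0 ψ θ fun z => ψ (Polynomial.aeval z p) * F z)
    {k : ℕ} (hk : k ≤ p.natDegree) : PlaneSHL0 ψ θ fun z => ψ (z ^ k) * F z := by
  obtain ⟨C, hC, h⟩ := exists_norm_pow_le p hp
  refine hF.of_norm_le (C := ‖algHomCLM ψ‖ * (2 * C)) hθ hpF
    (fun z hz => (hF.hol z hz).mul_left (hasDerivAt_pow k z)) (by positivity) fun z => ?_
  have hz := h k hk z
  rcases le_total ‖Polynomial.aeval z p‖ 1 with h1 | h1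
  · have h2 : ‖ψ (z ^ k)‖ ≤ ‖algHomCLM ψ‖ * (2 * C) := by
      refine (norm_complexAlgHom_le ψ _).trans (mul_le_mul_of_nonneg_left ?_ (norm_nonneg _))
      rw [norm_pow]
      nlinarith
    refine (norm_mul_le _ _).trans (mul_le_mul h2 ?_ (norm_nonneg _) (by positivity))
    linarith [norm_nonneg (ψ (Polynomial.aeval z p) * F z)]
  · have hn : 0 < ‖Polynomial.aeval z p‖ := zero_lt_one.trans_le h1
    have h0 : Polynomial.aeval z p ≠ 0 := norm_pos_iff.1 hn
    have h2 : ψ (z ^ k) * F z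
        = ψ (z ^ k / Polynomial.aeval z p) * (ψ (Polynomial.aeval z p) * F z) := by
      rw [← mul_assoc, ← map_mul, div_mul_cancel₀ _ h0]
    have h3 : ‖ψ (z ^ k / Polynomial.aeval z p)‖ ≤ ‖algHomCLM ψ‖ * (2 * C) := by
      refine (norm_complexAlgHom_le ψ _).trans (mul_le_mul_of_nonneg_left ?_ (norm_nonneg _))
      rw [norm_div, norm_pow, div_le_iff₀ hn]
      nlinarith
    rw [h2]
    refine (norm_mul_le _ _).trans (mul_le_mul h3 ?_ (norm_nonneg _) (by positivity))
    linarith [norm_nonneg (F z)]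

end Plane

end

/-! ### The contour integral over the boundary of the double sector. -/

noncomputable section

open MeasureTheory Filter Topology Paravector

section PlaneCalculus

variable {𝔅 : Type*} [NormedRing 𝔅] [NormedAlgebra ℝ 𝔅] {ψ : ℂ →ₐ[ℝ] 𝔅} {A F : ℂ → 𝔅} {ω θ φ : ℝ}

/-- The integral `(1/2π) ∫ A(z) dz/i F(z)` along the boundary of the double sector of
half-angle `φ`. -/
def planeCalculus (ψ : ℂ →ₐ[ℝ] 𝔅) (A F : ℂ → 𝔅) (φ : ℝ) : 𝔅 :=
  (1 / (2 * Real.pi)) • (algRayIntegral ψ A F (-φ) - algRayIntegral ψ A F φ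
    + algRayIntegral ψ A F (Real.pi - φ) - algRayIntegral ψ A F (Real.pi + φ))

theorem mem_angles_boundary (hω : 0 < ω) (hφ : φ ∈ Set.Ioo ω θ) (hθ : θ < Real.pi / 2) :
    (-φ ∈ angles θ ∧ |Real.cos (-φ)| ≤ Real.cos φ) ∧ (φ ∈ angles θ ∧ |Real.cos φ| ≤ Real.cos φ) ∧
    (Real.pi - φ ∈ angles θ ∧ |Real.cos (Real.pi - φ)| ≤ Real.cos φ) ∧
    (Real.pi + φ ∈ angles θ ∧ |Real.cos (Real.pi + φ)| ≤ Real.cos φ) := by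
  obtain ⟨h1, h2⟩ := hφ
  have h3 : |Real.cos φ| ≤ Real.cos φ :=
    (abs_of_nonneg (Real.cos_nonneg_of_neg_pi_div_two_le_of_le (by linarith) (by linarith))).le
  refine ⟨⟨Or.inl ⟨by linarith, by linarith⟩, by rwa [Real.cos_neg]⟩,
    ⟨Or.inl ⟨by linarith, by linarith⟩, h3⟩,
    ⟨Or.inr ⟨by linarith, by linarith⟩, by rwa [Real.cos_pi_sub, abs_neg]⟩,
    ⟨Or.inr ⟨by linarith, by linarith⟩, ?_⟩⟩
  rwa [add_comm, Real.cos_add_pi, abs_neg]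

theorem algRayIntegral_sum {n : ℕ} (c : ℕ → ℝ) (H : ℕ → ℂ → 𝔅) {α : ℝ}
    (hi : ∀ k < n, IntegrableOn (rayIntegrand ψ A (H k) α) (Set.Ioi 0)) :
    algRayIntegral ψ A (fun z => ∑ k ∈ Finset.range n, c k • H k z) α
      = ∑ k ∈ Finset.range n, c k • algRayIntegral ψ A (H k) α := by
  simp only [algRayIntegral]
  simp_rw [← integral_smul]
  rw [← integral_finsetSum (f := fun k t => c k • rayIntegrand ψ A (H k) α t) _
    fun k hk => (hi k (Finset.mem_range.1 hk)).smul (c k)]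
  refine integral_congr_ae (Eventually.of_forall fun t => ?_)
  simp only [rayIntegrand, Finset.mul_sum, mul_smul_comm]

theorem planeCalculus_sum {n : ℕ} (c : ℕ → ℝ) (H : ℕ → ℂ → 𝔅)
    (hω : ω ∈ Set.Ioo 0 (Real.pi / 2)) (hθ : θ ∈ Set.Ioo ω (Real.pi / 2))
    (hφ : φ ∈ Set.Ioo ω θ) (hA : IsPlaneResolvent ψ ω A) (hH : ∀ k < n, PlaneSHL0 ψ θ (H k)) :
    planeCalculus ψ A (fun z => ∑ k ∈ Finset.range n, c k • H k z) φ
      = ∑ k ∈ Finset.range n, c k • planeCalculus ψ A (H k) φ := by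
  have hθ0 : θ ∈ Set.Ioo 0 (Real.pi / 2) := ⟨hω.1.trans hθ.1, hθ.2⟩
  have hφ' : φ ∈ Set.Ioo ω (Real.pi / 2) := ⟨hφ.1, hφ.2.trans hθ.2⟩
  have hi : ∀ α, (α ∈ angles θ ∧ |Real.cos α| ≤ Real.cos φ) → ∀ k < n,
      IntegrableOn (rayIntegrand ψ A (H k) α) (Set.Ioi 0) := fun α hα k hk =>
    integrableOn_rayIntegrand_resolvent hω hθ0 hA (hH k hk) hφ' hα.1 hα.2
  obtain ⟨h1, h2, h3, h4⟩ := mem_angles_boundary hω.1 hφ hθ.2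
  simp only [planeCalculus]
  rw [algRayIntegral_sum c H (hi _ h1), algRayIntegral_sum c H (hi _ h2),
    algRayIntegral_sum c H (hi _ h3), algRayIntegral_sum c H (hi _ h4),
    ← Finset.sum_sub_distrib, ← Finset.sum_add_distrib, ← Finset.sum_sub_distrib, Finset.smul_sum]
  refine Finset.sum_congr rfl fun k _ => ?_
  simp only [← smul_sub, ← smul_add]
  rw [smul_comm]

theorem complexAlgHom_aeval_mul (ψ : ℂ →ₐ[ℝ] 𝔅) (p : Polynomial ℝ) (F : ℂ → 𝔅) :
    (fun z => ψ (Polynomial.aeval z p) * F z) = fun z => ∑ k ∈ Finset.range (p.natDegree + 1),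
      p.coeff k • (ψ (z ^ k) * F z) := by
  funext z
  rw [Polynomial.aeval_eq_sum_range, map_sum, Finset.sum_mul]
  refine Finset.sum_congr rfl fun k _ => ?_
  rw [map_smul, smul_mul_assoc]

end PlaneCalculus

/-! ### Applying the closed operator under the integral. -/

section Closed

variable {X : Type*} [NormedAddCommGroup X] [NormedSpace ℝ X] [CompleteSpace X] {T : X →ₗ.[ℝ] X}
  {ψ : ℂ →ₐ[ℝ] (X →L[ℝ] X)} {A F : ℂ → X →L[ℝ] X} {ω θ φ : ℝ}

theorem mem_graph_algRayIntegral (hT : T.IsClosed) {α : ℝ}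
    (hg : ∀ t, 0 < t → ∀ u,
      (A (rayPoint α t) u, A (rayPoint α t) (ψ (rayPoint α t) u) - u) ∈ T.graph)
    (h1 : IntegrableOn (rayIntegrand ψ A F α) (Set.Ioi 0))
    (h2 : IntegrableOn (rayIntegrand ψ A (fun z => ψ z * F z) α) (Set.Ioi 0))
    (h3 : IntegrableOn (rayIntegrand ψ (fun _ => 1) F α) (Set.Ioi 0)) (v : X) :
    (algRayIntegral ψ A F α v, algRayIntegral ψ A (fun z => ψ z * F z) α v
      - algRayIntegral ψ (fun _ => 1) F α v) ∈ T.graph := by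
  have h4 := h2.sub h3
  have e2 : algRayIntegral ψ A (fun z => ψ z * F z) α v - algRayIntegral ψ (fun _ => 1) F α v
      = ∫ t in Set.Ioi (0 : ℝ), (rayIntegrand ψ A (fun z => ψ z * F z) α t
        - rayIntegrand ψ (fun _ => 1) F α t) v := by
    rw [algRayIntegral, algRayIntegral, ← sub_apply, ← integral_sub h2 h3]
    exact ContinuousLinearMap.integral_apply h4 v
  rw [e2, algRayIntegral, ContinuousLinearMap.integral_apply h1]
  refine mem_graph_integral hT (h1.apply_continuousLinearMap v)
    (h4.apply_continuousLinearMap v) ?_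
  filter_upwards [ae_restrict_mem measurableSet_Ioi] with t ht
  have := hg t ht ((ψ (rayPoint α 1) * -ψ Complex.I * F (rayPoint α t)) v)
  have hc : ψ (rayPoint α t) * (ψ (rayPoint α 1) * -ψ Complex.I * F (rayPoint α t))
      = ψ (rayPoint α 1) * -ψ Complex.I * (ψ (rayPoint α t) * F (rayPoint α t)) := by
    rw [← map_neg, ← map_mul, ← mul_assoc, complexAlgHom_comm, mul_assoc]
  have e3 : (rayIntegrand ψ A (fun z => ψ z * F z) α t - rayIntegrand ψ (fun _ => 1) F α t) v
      = A (rayPoint α t) (ψ (rayPoint α t)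
        ((ψ (rayPoint α 1) * -ψ Complex.I * F (rayPoint α t)) v))
        - (ψ (rayPoint α 1) * -ψ Complex.I * F (rayPoint α t)) v := by
    rw [← mul_apply_eq_comp (ψ (rayPoint α t)), hc]
    simp only [rayIntegrand, one_mul]
    rfl
  rw [e3]
  exact this

/-- The step T f(T) = (zf)(T). Each ray leaves an extra integral of `F` without the resolvent; those
at ±φ are equal, as are those at π ± φ, and they enter with opposite signs. -/
theorem mem_graph_planeCalculus (hT : T.IsClosed) (hω : ω ∈ Set.Ioo 0 (Real.pi / 2))
    (hθ : θ ∈ Set.Ioo ω (Real.pi / 2)) (hφ : φ ∈ Set.Ioo ω θ) (hA : IsPlaneResolvent ψ ω A)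
    (hg : ∀ z ∈ planeExterior ω, ∀ u, (A z u, A z (ψ z u) - u) ∈ T.graph)
    (hF : PlaneSHL0 ψ θ F) (hzF : PlaneSHL0 ψ θ fun z => ψ z * F z) (v : X) :
    (planeCalculus ψ A F φ v, planeCalculus ψ A (fun z => ψ z * F z) φ v) ∈ T.graph := by
  have hθ0 : θ ∈ Set.Ioo 0 (Real.pi / 2) := ⟨hω.1.trans hθ.1, hθ.2⟩
  have hφ' : φ ∈ Set.Ioo ω (Real.pi / 2) := ⟨hφ.1, hφ.2.trans hθ.2⟩
  have key : ∀ α, (α ∈ angles θ ∧ |Real.cos α| ≤ Real.cos φ) →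
      (algRayIntegral ψ A F α v, algRayIntegral ψ A (fun z => ψ z * F z) α v
        - algRayIntegral ψ (fun _ => 1) F α v) ∈ T.graph := fun α hα =>
    mem_graph_algRayIntegral hT
      (fun t ht => hg _ (rayPoint_mem_planeExterior hω hφ' hα.2 ht))
      (integrableOn_rayIntegrand_resolvent hω hθ0 hA hF hφ' hα.1 hα.2)
      (integrableOn_rayIntegrand_resolvent hω hθ0 hA hzF hφ' hα.1 hα.2)
      (integrableOn_rayIntegrand (fun _ _ => continuousAt_const)
        (fun _ ht => hF.continuousAt hθ0 hα.1 ht) (integrableOn_one_mul hθ0 hF hzF hα.1)) v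
  obtain ⟨h1, h2, h3, h4⟩ := mem_angles_boundary hω.1 hφ hθ.2
  have hφ0 : 0 < φ := hω.1.trans hφ.1
  have c1 := algRayIntegral_one_eq hθ0 hF hzF (a := -φ) (b := φ) (by linarith)
    fun v hv => Or.inl ⟨by linarith [hv.1, hφ.2], by linarith [hv.2, hφ.2]⟩
  have c2 := algRayIntegral_one_eq hθ0 hF hzF (a := Real.pi - φ) (b := Real.pi + φ) (by linarith)
    fun v hv => Or.inr ⟨by linarith [hv.1, hφ.2], by linarith [hv.2, hφ.2]⟩
  have h5 := T.graph.smul_mem (1 / (2 * Real.pi)) (T.graph.sub_mem (T.graph.add_mem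
    (T.graph.sub_mem (key _ h1) (key _ h2)) (key _ h3)) (key _ h4))
  rw [c1, c2] at h5
  have gen : ∀ a b c e p q : X, a - b + c - e = a - p - (b - p) + (c - q) - (e - q) := by
    intros; abel
  refine (congrArg (· ∈ T.graph) (Prod.ext ?_ ?_)).mpr h5
  · rfl
  · exact congrArg (fun x : X => (1 / (2 * Real.pi)) • x) (gen
      (algRayIntegral ψ A (fun z => ψ z * F z) (-φ) v) (algRayIntegral ψ A (fun z => ψ z * F z) φ v)
      (algRayIntegral ψ A (fun z => ψ z * F z) (Real.pi - φ) v)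
      (algRayIntegral ψ A (fun z => ψ z * F z) (Real.pi + φ) v) _ _)

end Closed

end

/-! ### Independence of the slice and the angle, and the powers of T. -/

noncomputable section

open MeasureTheory Filter Topology

/-- All factors ±j stand between q or τ and u₀ or u₁, so they combine by j² = -1; the odd terms
cancel and the right side is free of j. -/
theorem slice_integrand_add_neg {𝔅 : Type*} [Ring 𝔅] [Algebra ℝ 𝔅] {j : 𝔅} (hj : j * j = -1)
    (q τ u₀ u₁ : 𝔅) (x y c s : ℝ) :
    (q * (x • 1 + -y • j) - τ) * ((c • 1 + s • j) * -j * (u₀ + j * u₁))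
      + (q * (x • 1 + -y • -j) - τ) * ((c • 1 + s • -j) * - -j * (u₀ + -j * u₁))
    = (2 : ℝ) • ((x • q - τ) * (s • u₀ + c • u₁) - (y • q) * (c • u₀ - s • u₁)) := by
  simp only [neg_smul, smul_neg, neg_neg, neg_mul, ← sub_eq_add_neg]
  have h1 : (c • (1 : 𝔅) + s • j) * -j = s • (1 : 𝔅) - c • j := by
    simp only [add_mul, smul_mul_assoc, mul_neg, one_mul, hj, smul_neg]; module
  have h2 : (c • (1 : 𝔅) - s • j) * j = s • (1 : 𝔅) + c • j := by
    simp only [sub_mul, smul_mul_assoc, one_mul, hj, smul_neg]; module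
  have h3 : ∀ w : 𝔅, j * (j * w) = -w := fun w => by rw [← mul_assoc, hj, neg_one_mul]
  rw [h1, h2]
  simp only [add_mul, sub_mul, mul_add, mul_sub, smul_mul_assoc, mul_smul_comm, one_mul, mul_one,
    mul_assoc, h3, mul_neg, smul_neg, smul_add, smul_sub, smul_smul]
  module

namespace CliffModule

open Paravector

variable {d : ℕ} {E : Type*} [NormedAddCommGroup E] [NormedSpace ℝ E]
  {T : CliffModule d E →ₗ.[ℝ] CliffModule d E} {ω θ : ℝ}

theorem omegaCalculus_eq_planeCalculus (f : Paravector d → Cliff d) {J : Paravector d}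
    (hJ : J ∈ unitSphere d) (φ : ℝ) : omegaCalculus T f φ J
      = planeCalculus (sliceHom E hJ) (sliceResolvent T J) (sliceFun E f J) φ := by
  simp only [omegaCalculus, planeCalculus, rayIntegral_eq f hJ]

/-- Real coefficients let p pass through the algebra homomorphism, so p(x + Jy) acts as ψ(p(z)). -/
theorem sliceFun_aeval_mul (p : Polynomial ℝ) (f : Paravector d → Cliff d) {J : Paravector d}
    (hJ : J ∈ unitSphere d) :
    sliceFun E (fun s => Polynomial.aeval s.toCliff p * f s) J
      = fun z => sliceHom E hJ (Polynomial.aeval z p) * sliceFun E f J z := by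
  funext z
  rw [sliceFun, leftMul_mul, ← leftMulHom_apply, ← Polynomial.aeval_algHom_apply,
    leftMulHom_apply, ← sliceHom_apply hJ, Polynomial.aeval_algHom_apply]
  rfl

theorem planeSHL0_sliceFun {f : Paravector d → Cliff d} (hθ : θ ∈ Set.Ioo 0 (Real.pi / 2))
    (hf : MemSHL0 θ f) {J : Paravector d} (hJ : J ∈ unitSphere d) :
    PlaneSHL0 (sliceHom E hJ) θ (sliceFun E f J) := by
  have hb : ∀ z, ‖sliceFun E f J z‖ ≤ ‖leftMulCLM d E‖ * ‖f (ofComplex J z)‖ := fun z =>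
    (leftMulCLM d E).le_opNorm _
  have hol : ∀ z ∈ planeSector θ, LeftHolAt (sliceHom E hJ) (sliceFun E f J) z :=
    fun z hz => leftHolAt_sliceFun hθ hf.slice hJ hz
  refine ⟨hol, ?_, fun φ hφ => ?_⟩
  · obtain ⟨C, hC⟩ := hf.bounded
    refine ⟨‖leftMulCLM d E‖ * C, fun z hz => (hb z).trans ?_⟩
    exact mul_le_mul_of_nonneg_left (hC _ ((ofComplex_mem_doubleSector_iff hJ hθ z).2 hz))
      (ContinuousLinearMap.opNorm_nonneg _)
  · refine ((hf.integrable J hJ φ hφ).const_mul ‖leftMulCLM d E‖).mono' ?_ ?_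
    · refine ContinuousOn.aestronglyMeasurable (fun t ht => ContinuousAt.continuousWithinAt ?_)
        measurableSet_Ioi
      have h2 := ContinuousAt.comp (f := rayPoint φ)
        (hol _ (ray_mem_planeSector hθ ht hφ)).continuousAt (continuous_rayPoint φ).continuousAt
      exact h2.norm.div continuousAt_id (ne_of_gt ht)
    · filter_upwards [ae_restrict_mem measurableSet_Ioi] with t ht
      have ht : 0 < t := ht
      rw [Real.norm_eq_abs, abs_of_nonneg (by positivity), ← mul_div_assoc, polar_eq_ofComplex]
      exact div_le_div_of_nonneg_right (hb _) ht.le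

variable [CompleteSpace E]

theorem IsBisectorial.isPlaneResolvent (hω : ω ∈ Set.Ioo 0 (Real.pi / 2)) (hT : IsBisectorial T ω)
    {J : Paravector d} (hJ : J ∈ unitSphere d) :
    IsPlaneResolvent (sliceHom E hJ) ω (sliceResolvent T J) := by
  constructor
  · intro z hz
    obtain ⟨q, τ, h⟩ := hT.exists_qPair hω hJ
    obtain ⟨a, A', hA, ha⟩ := rightHolAt_of_qPair (sliceHom E hJ) (isOpen_planeExterior ω)
      (fun z hz => (h z hz).1) hz
    refine ⟨a, A', hA.congr_of_eventuallyEq ?_, ha⟩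
    filter_upwards [(isOpen_planeExterior ω).mem_nhds hz] with w hw using (h w hw).2 J hJ
  · intro φ hφ
    obtain ⟨C, hC, h⟩ := hT.resolvent_bound φ hφ
    refine ⟨C, hC, fun v t ht hv => ?_⟩
    have h1 : ofComplex J (rayPoint v t) ∉ doubleSector d φ := by
      have h2 : (rayPoint v t).re = t * Real.cos v := re_ray t v
      rw [ofComplex_mem_doubleSector_iff hJ ⟨hω.1.trans hφ.1, hφ.2⟩, planeSector,
        Set.mem_ofPred_eq, h2, norm_rayPoint ht, abs_mul, abs_of_pos ht, mul_comm, not_lt]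
      exact mul_le_mul_of_nonneg_left hv ht.le
    have h2 : ‖ofComplex J (rayPoint v t)‖ = t := by rw [norm_ofComplex hJ, norm_rayPoint ht]
    have h3 := h _ h1 (norm_ne_zero_iff.1 (by rw [h2]; exact ht.ne'))
    rwa [h2] at h3

/-- The resolvent equation: with A = qψ(z̄) - τ, it follows from Tτ = 1 + 2xτ - |z|²q together with
z̄z = |z|² and z̄ = 2x - z. -/
theorem IsBisectorial.mem_graph_sliceResolvent (hω : ω ∈ Set.Ioo 0 (Real.pi / 2))
    (hT : IsBisectorial T ω) {J : Paravector d} (hJ : J ∈ unitSphere d) {z : ℂ}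
    (hz : z ∈ planeExterior ω) (u : CliffModule d E) :
    (sliceResolvent T J z u, sliceResolvent T J z (sliceHom E hJ z u) - u) ∈ T.graph := by
  obtain ⟨q, τ, h⟩ := hT.exists_qPair hω hJ
  obtain ⟨h1, h2⟩ := h z hz
  rw [h2 J hJ]
  have h3 := T.graph.sub_mem (h1.mem_fst (sliceHom E hJ (starRingEnd ℂ z) u)) (h1.mem_snd u)
  have h4 : sliceHom E hJ (starRingEnd ℂ z) (sliceHom E hJ z u) = (z.re ^ 2 + z.im ^ 2) • u := by
    rw [← mul_apply_eq_comp, ← map_mul, mul_comm, Complex.mul_conj, Complex.normSq_apply,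
      ← Complex.coe_algebraMap, AlgHom.commutes, Algebra.algebraMap_eq_smul_one, smul_apply,
      one_apply_eq_self]
    congr 1
    ring
  have h5 : sliceHom E hJ (starRingEnd ℂ z) u = (2 * z.re) • u - sliceHom E hJ z u := by
    have : starRingEnd ℂ z = (2 * z.re : ℝ) - z := by
      apply Complex.ext
      · simp; ring
      · simp
    rw [this, map_sub, ← Complex.coe_algebraMap, AlgHom.commutes, Algebra.algebraMap_eq_smul_one]
    rfl
  refine (congrArg (· ∈ T.graph) (Prod.ext ?_ ?_)).mpr h3
  · rfl
  · change q z (sliceHom E hJ (starRingEnd ℂ z) (sliceHom E hJ z u)) - τ z (sliceHom E hJ z u) - u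
      = τ z (sliceHom E hJ (starRingEnd ℂ z) u)
        - (u + (2 * z.re) • τ z u - (z.re ^ 2 + z.im ^ 2) • q z u)
    rw [h4, h5, map_smul, map_sub, map_smul]
    module

theorem rayIntegral_add_neg (hω : ω ∈ Set.Ioo 0 (Real.pi / 2)) (hθ : θ ∈ Set.Ioo 0 (Real.pi / 2))
    (hT : IsBisectorial T ω) {f : Paravector d → Cliff d} (hf : MemSHL0 θ f) {φ α : ℝ}
    (hφ : φ ∈ Set.Ioo ω (Real.pi / 2)) (hα : α ∈ angles θ) (hαφ : |Real.cos α| ≤ Real.cos φ)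
    {J J' : Paravector d} (hJ : J ∈ unitSphere d) (hJ' : J' ∈ unitSphere d) :
    rayIntegral T f J α + rayIntegral T f (-J) α
      = rayIntegral T f J' α + rayIntegral T f (-J') α := by
  obtain ⟨q, τ, h⟩ := hT.exists_qPair hω hJ
  obtain ⟨f₀, f₁, -, -, hf'⟩ := hf.slice
  have key : ∀ K (hK : K ∈ unitSphere d), rayIntegral T f K α + rayIntegral T f (-K) α
      = ∫ t in Set.Ioi (0 : ℝ), (2 : ℝ) •
        (((rayPoint α t).re • q (rayPoint α t) - τ (rayPoint α t)) *
          ((rayPoint α 1).im • leftMul (f₀ ((rayPoint α t).re, (rayPoint α t).im))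
            + (rayPoint α 1).re • leftMul (f₁ ((rayPoint α t).re, (rayPoint α t).im)))
        - ((rayPoint α t).im • q (rayPoint α t)) *
          ((rayPoint α 1).re • leftMul (f₀ ((rayPoint α t).re, (rayPoint α t).im))
            - (rayPoint α 1).im • leftMul (f₁ ((rayPoint α t).re, (rayPoint α t).im)))) := by
    intro K hK
    have hi : ∀ K (hK : K ∈ unitSphere d), IntegrableOn
        (rayIntegrand (sliceHom E hK) (sliceResolvent T K) (sliceFun E f K) α) (Set.Ioi 0) :=
      fun K hK => integrableOn_rayIntegrand_resolvent hω hθ (hT.isPlaneResolvent hω hK)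
        (planeSHL0_sliceFun hθ hf hK) hφ hα hαφ
    have hK' := neg_mem_unitSphere hK
    rw [rayIntegral_eq f hK, rayIntegral_eq f hK', algRayIntegral, algRayIntegral,
      ← integral_add (hi K hK) (hi (-K) hK')]
    refine setIntegral_congr_fun measurableSet_Ioi fun t ht => ?_
    set z := rayPoint α t with hz
    have hze : z ∈ planeExterior ω := rayPoint_mem_planeExterior hω hφ hαφ ht
    have hzs : ∀ J ∈ unitSphere d, slicePoint J z.re z.im ∈ doubleSector d θ := fun J hJ =>
      (ofComplex_mem_doubleSector_iff hJ hθ z).2 (ray_mem_planeSector hθ ht hα)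
    have hval := (hf' z.re z.im hzs).1
    have hj : leftMul (E := E) K.toCliff * leftMul K.toCliff = -1 := by
      rw [← sliceHom_I hK, ← map_mul, Complex.I_mul_I, map_neg, map_one]
    rw [← slice_integrand_add_neg hj]
    simp only [rayIntegrand]
    rw [← hz, (h z hze).2 K hK, (h z hze).2 (-K) hK', sliceHom_I, sliceHom_I, sliceFun, sliceFun,
      ofComplex, ofComplex, hval K hK, hval (-K) hK', toCliff_neg, sliceHom_eq, sliceHom_eq,
      sliceHom_eq, sliceHom_eq, toCliff_neg, leftMul_neg, leftMul_add, leftMul_add, leftMul_mul,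
      leftMul_mul, leftMul_neg, Complex.conj_re, Complex.conj_im]
  rw [key J hJ, key J' hJ']

theorem omegaCalculus_congr (hω : ω ∈ Set.Ioo 0 (Real.pi / 2)) (hθ : θ ∈ Set.Ioo ω (Real.pi / 2))
    (hT : IsBisectorial T ω) {f : Paravector d → Cliff d} (hf : MemSHL0 θ f) {φ φ' : ℝ}
    (hφ : φ ∈ Set.Ioo ω θ) (hφ' : φ' ∈ Set.Ioo ω θ) {J J' : Paravector d}
    (hJ : J ∈ unitSphere d) (hJ' : J' ∈ unitSphere d) :
    omegaCalculus T f φ J = omegaCalculus T f φ' J' := by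
  have hθ0 : θ ∈ Set.Ioo 0 (Real.pi / 2) := ⟨hω.1.trans hθ.1, hθ.2⟩
  -- Cosine decreases only on [0, π], whence the alternative; it is excluded below, where b exceeds
  -- ω > 0.
  have angle : ∀ a b : ℝ, a ∈ Set.Ioo ω θ → b ≤ a →
      |Real.cos a| ≤ Real.cos b ∨ b < 0 := by
    intro a b ha hba
    rcases lt_or_ge b 0 with hb | hb
    · exact Or.inr hb
    · left
      rw [abs_of_nonneg (Real.cos_nonneg_of_neg_pi_div_two_le_of_le
        (by linarith [hω.1, ha.1, Real.pi_pos]) (by linarith [ha.2, hθ.2]))]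
      exact Real.cos_le_cos_of_nonneg_of_le_pi hb (by linarith [ha.2, hθ.2, hω.1, hω.2]) hba
  have rot : ∀ K ∈ unitSphere d, ∀ a b : ℝ, ω < a → a ≤ b → b < θ →
      rayIntegral T f K b = rayIntegral T f K a ∧
      rayIntegral T f K (Real.pi - a) = rayIntegral T f K (Real.pi - b) := by
    intro K hK a b ha hab hb
    have ha' : a ∈ Set.Ioo ω (Real.pi / 2) := ⟨ha, by linarith [hθ.2]⟩
    have hv : ∀ v ∈ Set.Icc a b, |Real.cos v| ≤ Real.cos a := fun v hv =>
      (angle v a ⟨by linarith [hv.1], by linarith [hv.2]⟩ hv.1).resolve_right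
        (by linarith [hω.1])
    simp only [rayIntegral_eq f hK]
    constructor
    · refine algRayIntegral_resolvent_eq hω hθ0 (hT.isPlaneResolvent hω hK)
        (planeSHL0_sliceFun hθ0 hf hK) ha' hab fun v hvm => ⟨Or.inl ?_, hv v hvm⟩
      exact ⟨by linarith [hvm.1, hω.1, hθ0.1], by linarith [hvm.2]⟩
    · refine algRayIntegral_resolvent_eq hω hθ0 (hT.isPlaneResolvent hω hK)
        (planeSHL0_sliceFun hθ0 hf hK) ha' (by linarith) fun v hvm => ⟨Or.inr ?_, ?_⟩
      · exact ⟨by linarith [hvm.1], by linarith [hvm.2, hω.1, hθ0.1]⟩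
      · have := hv (Real.pi - v) ⟨by linarith [hvm.2], by linarith [hvm.1]⟩
        rwa [Real.cos_pi_sub, abs_neg] at this
  have rot' : ∀ K ∈ unitSphere d, rayIntegral T f K φ = rayIntegral T f K φ' ∧
      rayIntegral T f K (Real.pi - φ) = rayIntegral T f K (Real.pi - φ') := by
    intro K hK
    rcases le_total φ φ' with h | h
    · have := rot K hK φ φ' hφ.1 h hφ'.2
      exact ⟨this.1.symm, this.2⟩
    · have := rot K hK φ' φ hφ'.1 h hφ.2
      exact ⟨this.1, this.2.symm⟩
  obtain ⟨-, h2, h3, -⟩ := mem_angles_boundary hω.1 hφ' hθ.2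
  have hφ2 : φ' ∈ Set.Ioo ω (Real.pi / 2) := ⟨hφ'.1, hφ'.2.trans hθ.2⟩
  rw [omegaCalculus_eq, omegaCalculus_eq, (rot' J hJ).1, (rot' J hJ).2,
    (rot' (-J) (neg_mem_unitSphere hJ)).1, (rot' (-J) (neg_mem_unitSphere hJ)).2,
    rayIntegral_add_neg hω hθ0 hT hf hφ2 h2.1 h2.2 hJ hJ',
    rayIntegral_add_neg hω hθ0 hT hf hφ2 h3.1 h3.2 hJ hJ']

/-- Each application of `T` multiplies the integrand by one more z, as long as the product stays in
the class. -/
theorem mem_graph_opPow_planeCalculus (hω : ω ∈ Set.Ioo 0 (Real.pi / 2))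
    (hθ : θ ∈ Set.Ioo ω (Real.pi / 2)) (hT : IsBisectorial T ω) {φ : ℝ} (hφ : φ ∈ Set.Ioo ω θ)
    {J : Paravector d} (hJ : J ∈ unitSphere d) {F : ℂ → CliffModule d E →L[ℝ] CliffModule d E}
    {n : ℕ} (hF : ∀ k ≤ n, PlaneSHL0 (sliceHom E hJ) θ fun z => sliceHom E hJ (z ^ k) * F z)
    (v : CliffModule d E) {k : ℕ} (hk : k ≤ n) :
    (planeCalculus (sliceHom E hJ) (sliceResolvent T J) F φ v,
      planeCalculus (sliceHom E hJ) (sliceResolvent T J) (fun z => sliceHom E hJ (z ^ k) * F z) φ v)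
      ∈ (opPow T k).graph := by
  induction k with
  | zero =>
    rw [mem_graph_opPow_zero]
    simp
  | succ k ih =>
    rw [mem_graph_opPow_succ]
    refine ⟨_, ih (by omega), ?_⟩
    have e : (fun z => sliceHom E hJ (z ^ (k + 1)) * F z)
        = fun z => sliceHom E hJ z * (sliceHom E hJ (z ^ k) * F z) := by
      funext z
      rw [pow_succ', map_mul, mul_assoc]
    have h1 := hF (k + 1) hk
    rw [e] at h1 ⊢
    exact mem_graph_planeCalculus hT.isClosedOperator.closed hω hθ hφ (hT.isPlaneResolvent hω hJ)
      (fun z hz u => hT.mem_graph_sliceResolvent hω hJ hz u) (hF k (by omega)) h1 v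

end CliffModule

end

theorem mainTheorem11 {d : ℕ} {E : Type*} [NormedAddCommGroup E] [NormedSpace ℝ E]
    [CompleteSpace E] (T : CliffModule d E →ₗ.[ℝ] CliffModule d E) (ω θ : ℝ)
    (hω : ω ∈ Set.Ioo 0 (Real.pi / 2)) (hθ : θ ∈ Set.Ioo ω (Real.pi / 2))
    (hT : CliffModule.IsBisectorial T ω)
    (f : Paravector d → Cliff d) (hf : MemSHL0 θ f)
    (n : ℕ) (p : Polynomial ℝ) (hp : p.degree = n)
    (hpf : MemSHL0 θ (fun s => Polynomial.aeval s.toCliff p * f s))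
    (φ : ℝ) (hφ : φ ∈ Set.Ioo ω θ) (J : Paravector d) (hJ : J ∈ Paravector.unitSphere d) :
    (∀ v, CliffModule.omegaCalculus T f φ J v ∈ (opPow T n).domain) ∧
    ∀ φ' ∈ Set.Ioo ω θ, ∀ J' ∈ Paravector.unitSphere d, ∀ v,
      ∃ h : CliffModule.omegaCalculus T f φ J v ∈ (polyOp T p).domain,
        CliffModule.omegaCalculus T (fun s => Polynomial.aeval s.toCliff p * f s) φ' J' v
          = polyOp T p ⟨CliffModule.omegaCalculus T f φ J v, h⟩ := by
  have hθ0 : θ ∈ Set.Ioo 0 (Real.pi / 2) := ⟨hω.1.trans hθ.1, hθ.2⟩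
  have hp0 : p ≠ 0 := by
    rintro rfl
    simp at hp
  have hn : p.natDegree = n := Polynomial.natDegree_eq_of_degree_eq_some hp
  have hF := CliffModule.planeSHL0_sliceFun (E := E) hθ0 hf hJ
  have hG := CliffModule.planeSHL0_sliceFun (E := E) hθ0 hpf hJ
  rw [CliffModule.sliceFun_aeval_mul p f hJ] at hG
  have hk : ∀ k ≤ p.natDegree, PlaneSHL0 (CliffModule.sliceHom E hJ) θ
      fun z => CliffModule.sliceHom E hJ (z ^ k) * CliffModule.sliceFun E f J z :=
    fun k hk => hF.pow_mul hθ0 hp0 hG hk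
  have key := fun v k hkn => CliffModule.mem_graph_opPow_planeCalculus hω hθ hT hφ hJ hk v
    (k := k) hkn
  simp only [← CliffModule.omegaCalculus_eq_planeCalculus f hJ φ] at key
  refine ⟨fun v => LinearPMap.mem_domain_of_mem_graph (hn ▸ key v p.natDegree le_rfl),
    fun φ' hφ' J' hJ' v => ?_⟩
  obtain ⟨h, h'⟩ := polyOp_apply_of_mem_graph T p (key v)
  refine ⟨h, ?_⟩
  -- Independence moves the integral for pf to the same φ and `J` as that for f, where the powers
  -- can be compared.
  rw [h', CliffModule.omegaCalculus_congr hω hθ hT hpf hφ' hφ hJ' hJ,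
    CliffModule.omegaCalculus_eq_planeCalculus _ hJ, CliffModule.sliceFun_aeval_mul p f hJ]
  rw [complexAlgHom_aeval_mul, planeCalculus_sum (fun k => p.coeff k)
    (fun k z => CliffModule.sliceHom E hJ (z ^ k) * CliffModule.sliceFun E f J z) hω hθ hφ
    (hT.isPlaneResolvent hω hJ) fun k hk' => hk k (Nat.lt_succ_iff.1 hk'), sum_apply]
  rfl
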